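/- Let $\mathcal J$ be the set of inclusions $S^{d-1}\to D^{d}$, $d\ge 0$ (with $S^{-1}=\emptyset$), regarded as a discrete category over the arrow category $\mathbf{Top}^{\mathbf 2}$. *Relative cell complexes.* A *stratum* on a space $X$ is a set $S$ of cells, each $s\in S$ with a shape $\kappa_s=(S^{d_s-1}\to D^{d_s})\in\mathcal J$ and a continuous attaching map $b_s\colon S^{d_s-1}\to X$; its *body* is the pushout of $X\leftarrow\coprod_s S^{d_s-1}\to\coprod_s D^{d_s}$. A *relative cell complex* on a map $f\colon X\to Y$ is a sequence of strata $(X_n,S_n)_{n\in\mathbb N}$ with $X_0= X$, with $X_{n+1}$ the body of $(X_n,S_n)$, with $X_0\to\operatorname{colim}X_n= Y$ equal to $f$, and *proper*: for $s\in S_n$ the map $b_s$ does not factor through $X_m$ for any $m<n$. (Pushouts, colimits and $X_0$ are taken up to specified isomorphism.) A morphism is a sequence of maps $f_n\colon X_n\to X'_n$ and shape-preserving functions $p_n\colon S_n\to S'_n$ with $f_n b_s=b_{p_n(s)}$ and with $f_{n+1}$ induced by $(f_n,p_n)$. This defines a category $\mathbf{CellCx}$ with forgetful functor $U\colon\mathbf{CellCx}\to\mathbf{Top}^{\mathbf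 2}$, and $\eta\colon\mathcal J\to\mathbf{CellCx}$ sends a map of $\mathcal J$ to its height-one complex with a single cell. If $A$ is a relative cell complex on $f\colon X\to Y$ and $B$ one on $g\colon Y\to Z$, a *composite* $B*A$ is a relative cell complex on $gf$ whose cells are those of $A$ and those of $B$ (disjoint union), with the same shapes and the same characteristic maps to $Z$; properness then forces each cell into the lowest possible stratum. *Left maps.* An algebraic weak factorisation system (awfs) $(L,R)$ on $\mathbf{Top}$ is a functorial factorisation $f=Rf\circ Lf$ through a functor $M\colon\mathbf{Top}^{\mathbf 2}\to\mathbf{Top}$, with a comonad structure on the copointed endofunctor $L$ (comultiplication $(1,\delta_f)$) and a monad structure on the pointed endofunctor $R$ (multiplication $(\mu_f,1)$), such that $(\delta_f,\mu_f)\colon LRf\to RLf$ is a distributive law of the comonad over the monad. $L\text{-}\mathbf{Map}$ is the category of $L$-coalgebras, over $\mathbf{Top}^{\mathbf 2}$. The composite of left maps $(f,\alpha)$ and $(g,\beta)$, $f\colon X\to Y$, $g\colon Y\to Z$, is $(gf,\beta\bullet\alpha)$ with $\beta\bullet\alpha=\mu_{gf}\circ M\big(M(1,g)\circ\alpha,\,1\big)\circ\beta$.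 **Proposition.** Any two composable relative cell complexes have a composite. For any awfs $(L,R)$ on $\mathbf{Top}$ and any functor $F\colon\mathcal J\to L\text{-}\mathbf{Map}$ over $\mathbf{Top}^{\mathbf 2}$, there is a unique functor $F'\colon\mathbf{CellCx}\to L\text{-}\mathbf{Map}$ over $\mathbf{Top}^{\mathbf 2}$ such that $F=F'\circ\eta$ and $F'$ preserves composition, i.e. $F'$ sends every composite $B*A$ to the composite left map $F'B\bullet F'A$. -/

import Mathlib

open CategoryTheory CategoryTheory.Limits

universe v w u

/-! ### Algebraic weak factorisation systems -/

/-- A functorial factorisation on `C`: a central functor `M : C² ⥤ C` together with natural maps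
`lam f : dom f ⟶ M f` and `rho f : M f ⟶ cod f` whose composite is `f`. -/
structure FunctFact (C : Type w) [Category.{v} C] where
  M : Arrow C ⥤ C
  lam (f : Arrow C) : f.left ⟶ M.obj f
  rho (f : Arrow C) : M.obj f ⟶ f.right
  lam_naturality {f g : Arrow C} (φ : f ⟶ g) : φ.left ≫ lam g = lam f ≫ M.map φ
  rho_naturality {f g : Arrow C} (φ : f ⟶ g) : M.map φ ≫ rho g = rho f ≫ φ.right
  fac (f : Arrow C) : lam f ≫ rho f = f.hom

namespace FunctFact

variable {C : Type w} [Category.{v} C] (W : FunctFact C)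

/-- The domain-preserving endofunctor `L` of `C²`, with `L f = lam f`. -/
abbrev L : Arrow C ⥤ Arrow C where
  obj f := Arrow.mk (W.lam f)
  map φ := Arrow.homMk φ.left (W.M.map φ) (W.lam_naturality φ)

/-- The codomain-preserving endofunctor `R` of `C²`, with `R f = rho f`. -/
abbrev R : Arrow C ⥤ Arrow C where
  obj f := Arrow.mk (W.rho f)
  map φ := Arrow.homMk (W.M.map φ) φ.right (W.rho_naturality φ)

/-- The copoint `(1, R f) : L f ⟶ f`. -/
abbrev ε : W.L ⟶ 𝟭 (Arrow C) where
  app f := Arrow.homMk (𝟙 f.left) (W.rho f) ((Category.id_comp _).trans (W.fac f).symm)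
  naturality _ _ φ := Arrow.hom_ext _ _
    ((Category.comp_id _).trans (Category.id_comp _).symm) (W.rho_naturality φ)

/-- The point `(L f, 1) : f ⟶ R f`. -/
abbrev η : 𝟭 (Arrow C) ⟶ W.R where
  app f := Arrow.homMk (W.lam f) (𝟙 f.right) ((W.fac f).trans (Category.comp_id _).symm)
  naturality _ _ φ := Arrow.hom_ext _ _
    (W.lam_naturality φ) ((Category.comp_id _).trans (Category.id_comp _).symm)

end FunctFact

/-- A functorial factorisation whose copointed endofunctor `L` is made into a comonad and whose
pointed endofunctor `R` is made into a monad. -/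
structure PreAWFS (C : Type w) [Category.{v} C] extends FunctFact C where
  δ : toFunctFact.L ⟶ toFunctFact.L ⋙ toFunctFact.L
  coassoc (f : Arrow C) :
    δ.app f ≫ toFunctFact.L.map (δ.app f) = δ.app f ≫ δ.app (toFunctFact.L.obj f)
  left_counit (f : Arrow C) : δ.app f ≫ toFunctFact.ε.app (toFunctFact.L.obj f) = 𝟙 _
  right_counit (f : Arrow C) : δ.app f ≫ toFunctFact.L.map (toFunctFact.ε.app f) = 𝟙 _
  μ : toFunctFact.R ⋙ toFunctFact.R ⟶ toFunctFact.R
  assoc (f : Arrow C) :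
    toFunctFact.R.map (μ.app f) ≫ μ.app f = μ.app (toFunctFact.R.obj f) ≫ μ.app f
  left_unit (f : Arrow C) : toFunctFact.η.app (toFunctFact.R.obj f) ≫ μ.app f = 𝟙 _
  right_unit (f : Arrow C) : toFunctFact.R.map (toFunctFact.η.app f) ≫ μ.app f = 𝟙 _

namespace PreAWFS

variable {C : Type w} [Category.{v} C] (W : PreAWFS C)

/-- The comonad `(L, ε, δ)` on `C²`. -/
def comonad : Comonad (Arrow C) where
  toFunctor := W.L
  ε := W.ε
  δ := W.δ
  coassoc := W.coassoc
  left_counit := W.left_counit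
  right_counit := W.right_counit

/-- The monad `(R, η, μ)` on `C²`. -/
def monad : Monad (Arrow C) where
  toFunctor := W.R
  η := W.η
  μ := W.μ
  assoc := W.assoc
  left_unit := W.left_unit
  right_unit := W.right_unit

/-- The nontrivial component `M f ⟶ M (L f)` of the comultiplication. -/
def comul (f : Arrow C) : W.M.obj f ⟶ W.M.obj (W.L.obj f) := (W.δ.app f).right

/-- The nontrivial component `M (R f) ⟶ M f` of the multiplication. -/
def mul (f : Arrow C) : W.M.obj (W.R.obj f) ⟶ W.M.obj f := (W.μ.app f).left

/-- The component `(δ_f, μ_f) : L (R f) ⟶ R (L f)` of the transformation `Δ : LR ⟶ RL`. -/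
def Δ (f : Arrow C) : W.L.obj (W.R.obj f) ⟶ W.R.obj (W.L.obj f) :=
  Arrow.homMk (W.comul f) (W.mul f) (by
    have h₁ := congrArg CommaMorphism.right (W.left_counit f)
    have h₂ := congrArg CommaMorphism.left (W.left_unit f)
    simp at h₁ h₂
    exact h₁.trans h₂.symm)

end PreAWFS

/-- An algebraic weak factorisation system on `C`: the transformation `Δ : LR ⟶ RL` is moreover a
distributive law of the comonad `L` over the monad `R`. -/
structure AWFS (C : Type w) [Category.{v} C] extends PreAWFS C where
  distrib_unit (f : Arrow C) : toFunctFact.L.map (toFunctFact.η.app f) ≫ toPreAWFS.Δ f = toFunctFact.η.app (toFunctFact.L.obj f)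
  distrib_counit (f : Arrow C) : toPreAWFS.Δ f ≫ toFunctFact.R.map (toFunctFact.ε.app f) = toFunctFact.ε.app (toFunctFact.R.obj f)
  distrib_mul (f : Arrow C) :
    toFunctFact.L.map (μ.app f) ≫ toPreAWFS.Δ f =
      toPreAWFS.Δ (toFunctFact.R.obj f) ≫ toFunctFact.R.map (toPreAWFS.Δ f) ≫ μ.app (toFunctFact.L.obj f)
  distrib_comul (f : Arrow C) :
    toPreAWFS.Δ f ≫ toFunctFact.R.map (δ.app f) =
      δ.app (toFunctFact.R.obj f) ≫ toFunctFact.L.map (toPreAWFS.Δ f) ≫ toPreAWFS.Δ (toFunctFact.L.obj f)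

namespace AWFS

variable {C : Type w} [Category.{v} C] (W : AWFS C)

/-- The category of left maps: coalgebras for the comonad `L`. -/
abbrev LMap := W.comonad.Coalgebra

/-- The forgetful functor from left maps to arrows. -/
abbrev forget : W.LMap ⥤ Arrow C := W.comonad.forget

/-- A left map structure on `f`: an `L`-coalgebra structure on the arrow `f`. -/
structure LeftStr {X Y : C} (f : X ⟶ Y) where
  a : Arrow.mk f ⟶ W.L.obj (Arrow.mk f)
  counit : a ≫ W.ε.app (Arrow.mk f) = 𝟙 _
  coassoc : a ≫ W.δ.app (Arrow.mk f) = a ≫ W.L.map a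

namespace LeftStr

variable {W} {X Y Z : C} {f : X ⟶ Y} {g : Y ⟶ Z}

/-- A map with a left map structure, as a left map. -/
def toLMap (α : W.LeftStr f) : W.LMap where
  A := Arrow.mk f
  a := α.a
  counit := α.counit
  coassoc := α.coassoc

/-- The structure map `Y ⟶ M f`; the domain component of a coalgebra structure is the identity. -/
def str (α : W.LeftStr f) : Y ⟶ W.M.obj (Arrow.mk f) := α.a.right

lemma a_left (α : W.LeftStr f) : α.a.left = 𝟙 X :=
  (Category.comp_id _).symm.trans (congrArg CommaMorphism.left α.counit)

lemma str_rho (α : W.LeftStr f) : α.str ≫ W.rho (Arrow.mk f) = 𝟙 Y :=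
  congrArg CommaMorphism.right α.counit

lemma comp_str (α : W.LeftStr f) : f ≫ α.str = W.lam (Arrow.mk f) := by
  have h : α.a.left ≫ W.lam (Arrow.mk f) = f ≫ α.str := Arrow.w α.a
  rw [α.a_left] at h
  exact h.symm.trans (Category.id_comp _)

lemma str_comul (α : W.LeftStr f) :
    α.str ≫ W.comul (Arrow.mk f) = α.str ≫ W.M.map α.a :=
  congrArg CommaMorphism.right α.coassoc

/-- The square `(1, g) : f ⟶ f ≫ g`. -/
def postcomp (f : X ⟶ Y) (g : Y ⟶ Z) : Arrow.mk f ⟶ Arrow.mk (f ≫ g) :=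
  Arrow.homMk (𝟙 X) g (Category.id_comp _)

/-- The square `(M(1, g) ∘ α, 1) : g ⟶ R (f ≫ g)`. -/
def push (α : W.LeftStr f) (g : Y ⟶ Z) : Arrow.mk g ⟶ W.R.obj (Arrow.mk (f ≫ g)) :=
  Arrow.homMk (α.str ≫ W.M.map (postcomp f g)) (𝟙 Z) (by
    have h : W.M.map (postcomp f g) ≫ W.rho (Arrow.mk (f ≫ g)) =
      W.rho (Arrow.mk f) ≫ g := W.rho_naturality (postcomp f g)
    change (α.str ≫ W.M.map (postcomp f g)) ≫ W.rho (Arrow.mk (f ≫ g)) = g ≫ 𝟙 Z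
    rw [Category.assoc, h, reassoc_of% α.str_rho, Category.comp_id])

/-- The structure map `μ ∘ M(M(1, g) ∘ α, 1) ∘ β : Z ⟶ M (f ≫ g)` of the composite. -/
def compStr (α : W.LeftStr f) (β : W.LeftStr g) : Z ⟶ W.M.obj (Arrow.mk (f ≫ g)) :=
  β.str ≫ W.M.map (α.push g) ≫ W.mul (Arrow.mk (f ≫ g))

lemma _root_.PreAWFS.mul_rho (V : PreAWFS C) (h : Arrow C) :
    V.mul h ≫ V.rho h = V.rho (V.R.obj h) := by
  have h₁ : (V.μ.app h).right = 𝟙 h.right :=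
    (Category.id_comp _).symm.trans (congrArg CommaMorphism.right (V.left_unit h))
  have h₂ : V.mul h ≫ V.rho h = V.rho (V.R.obj h) ≫ (V.μ.app h).right :=
    Arrow.w (V.μ.app h)
  rw [h₂, h₁]
  exact Category.comp_id _

lemma _root_.PreAWFS.lam_mul (V : PreAWFS C) (h : Arrow C) :
    V.lam (V.R.obj h) ≫ V.mul h = 𝟙 (V.M.obj h) :=
  congrArg CommaMorphism.left (V.left_unit h)

lemma compStr_rho (α : W.LeftStr f) (β : W.LeftStr g) :
    α.compStr β ≫ W.rho (Arrow.mk (f ≫ g)) = 𝟙 Z := by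
  have h : W.M.map (α.push g) ≫ W.rho (W.R.obj (Arrow.mk (f ≫ g))) =
      W.rho (Arrow.mk g) := (W.rho_naturality (α.push g)).trans (Category.comp_id _)
  rw [compStr, Category.assoc, Category.assoc, PreAWFS.mul_rho, h, str_rho]

lemma comp_compStr' (α : W.LeftStr f) (β : W.LeftStr g) :
    g ≫ α.compStr β = α.str ≫ W.M.map (postcomp f g) := by
  have h : W.lam (Arrow.mk g) ≫ W.M.map (α.push g) =
      (α.str ≫ W.M.map (postcomp f g)) ≫ W.lam (W.R.obj (Arrow.mk (f ≫ g))) :=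
    (W.lam_naturality (α.push g)).symm
  rw [compStr, reassoc_of% β.comp_str, ← Category.assoc, h, Category.assoc, PreAWFS.lam_mul]
  exact Category.comp_id _

lemma comp_compStr (α : W.LeftStr f) (β : W.LeftStr g) :
    (f ≫ g) ≫ α.compStr β = W.lam (Arrow.mk (f ≫ g)) := by
  rw [Category.assoc, comp_compStr', reassoc_of% α.comp_str]
  exact (W.lam_naturality (postcomp f g)).symm.trans (Category.id_comp _)

/-- The coalgebra square of the composite. -/
def compA (α : W.LeftStr f) (β : W.LeftStr g) :
    Arrow.mk (f ≫ g) ⟶ W.L.obj (Arrow.mk (f ≫ g)) :=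
  Arrow.homMk (𝟙 X) (α.compStr β) ((Category.id_comp _).trans (α.comp_compStr β).symm)

lemma distrib (h : Arrow C) :
    W.mul h ≫ W.comul h =
      W.comul (W.R.obj h) ≫ W.M.map (W.Δ h) ≫ W.mul (W.L.obj h) :=
  congrArg CommaMorphism.right (W.distrib_comul h)

lemma comul_naturality {h k : Arrow C} (φ : h ⟶ k) :
    W.M.map φ ≫ W.comul k = W.comul h ≫ W.M.map (W.L.map φ) :=
  congrArg CommaMorphism.right (W.δ.naturality φ)

lemma mul_naturality {h k : Arrow C} (φ : h ⟶ k) :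
    W.M.map (W.R.map φ) ≫ W.mul k = W.mul h ≫ W.M.map φ :=
  congrArg CommaMorphism.left (W.μ.naturality φ)

lemma compStr_comul (α : W.LeftStr f) (β : W.LeftStr g) :
    α.compStr β ≫ W.comul (Arrow.mk (f ≫ g)) = α.compStr β ≫ W.M.map (α.compA β) := by
  have key : β.a ≫ W.L.map (α.push g) ≫ W.Δ (Arrow.mk (f ≫ g)) =
      α.push g ≫ W.R.map (α.compA β) := by
    refine Arrow.hom_ext _ _ ?_ ?_
    · change β.a.left ≫ (α.str ≫ W.M.map (postcomp f g)) ≫ W.comul (Arrow.mk (f ≫ g)) =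
        (α.str ≫ W.M.map (postcomp f g)) ≫ W.M.map (α.compA β)
      have hs : α.a ≫ W.L.map (postcomp f g) = postcomp f g ≫ α.compA β := by
        refine Arrow.hom_ext _ _ ?_ ?_
        · change α.a.left ≫ 𝟙 X = 𝟙 X ≫ 𝟙 X
          rw [α.a_left]
        · exact (α.comp_compStr' β).symm
      rw [β.a_left, Category.assoc, comul_naturality, reassoc_of% α.str_comul, ← W.M.map_comp, hs,
        W.M.map_comp, Category.assoc]
      exact Category.id_comp _
    · change β.str ≫ W.M.map (α.push g) ≫ W.mul (Arrow.mk (f ≫ g)) = 𝟙 Z ≫ α.compStr β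
      rw [Category.id_comp, compStr]
  rw [compStr, Category.assoc, Category.assoc, Category.assoc, Category.assoc, distrib,
    ← mul_naturality, ← Category.assoc (W.M.map (α.push g)), comul_naturality,
    Category.assoc, reassoc_of% β.str_comul]
  simp only [← Category.assoc]
  congr 1
  simp only [Category.assoc, ← W.M.map_comp]
  rw [key]

/-- The composite left map structure `β • α` on `f ≫ g`. -/
def comp (α : W.LeftStr f) (β : W.LeftStr g) : W.LeftStr (f ≫ g) where
  a := α.compA β
  counit := Arrow.hom_ext _ _ (Category.comp_id _) (α.compStr_rho β)
  coassoc := by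
    refine Arrow.hom_ext _ _ ?_ (α.compStr_comul β)
    have h : (W.δ.app (Arrow.mk (f ≫ g))).left = 𝟙 X :=
      (Category.comp_id _).symm.trans
        (congrArg CommaMorphism.left (W.left_counit (Arrow.mk (f ≫ g))))
    change 𝟙 X ≫ (W.δ.app (Arrow.mk (f ≫ g))).left = 𝟙 X ≫ 𝟙 X
    rw [h]

end LeftStr

/-- `IsComposite a b c`: the left maps `a` and `b` are composable and `c` is the composite left map
`b • a`. -/
inductive IsComposite : W.LMap → W.LMap → W.LMap → Prop
  | mk {X Y Z : C} {f : X ⟶ Y} {g : Y ⟶ Z} (α : W.LeftStr f) (β : W.LeftStr g) :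
      IsComposite α.toLMap β.toLMap (α.comp β).toLMap

end AWFS

/-! ### Strata and relative cell complexes -/

open TopCat in
/-- The set `J` of inclusions `S^{n-1} ⟶ D^n`, `n ≥ 0`, as a discrete category over arrows. -/
noncomputable def genCells : Discrete ℕ ⥤ Arrow TopCat.{u} :=
  Discrete.functor fun d => Arrow.mk (diskBoundaryInclusion.{u} d)

open TopCat in
/-- A stratum with boundary `X`, whose body is presented by the map `i : X ⟶ X'`. The set of cells
is graded by the shape of the cells: `cells d` is the set of cells `s` with `κ_s = (S^{d-1} ⟶ D^d)`.
The map `char s` is the structure map of the pushout on the summand `s`. -/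
structure Stratum {X X' : TopCat.{u}} (i : X ⟶ X') where
  cells : ℕ → Type u
  attach {d : ℕ} (s : cells d) : ∂𝔻 d ⟶ X
  char {d : ℕ} (s : cells d) : 𝔻 d ⟶ X'
  isPushout : IsPushout
    (Limits.Sigma.map fun s : Σ d, cells d => diskBoundaryInclusion.{u} s.1)
    (Limits.Sigma.desc fun s : Σ d, cells d => attach s.2)
    (Limits.Sigma.desc fun s : Σ d, cells d => char s.2) i

open TopCat in
/-- A relative cell complex structure on `f : X ⟶ Y`: a proper connected sequence of strata, with
boundary `X`, whose transfinite composite is `f`. Bodies of strata and transfinite composites are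
only determined up to isomorphism, so any pushout and any colimit is allowed. -/
structure CellStr {X Y : TopCat.{u}} (f : X ⟶ Y) where
  stage : ℕ ⥤ TopCat.{u}
  base : X ≅ stage.obj 0
  stratum (n : ℕ) : Stratum (stage.map (homOfLE n.le_succ))
  proper (n d : ℕ) (s : (stratum n).cells d) (m : ℕ) (h : m < n) :
    ¬ ∃ b : ∂𝔻 d ⟶ stage.obj m, b ≫ stage.map (homOfLE h.le) = (stratum n).attach s
  toBody (n : ℕ) : stage.obj n ⟶ Y
  toBody_naturality {m n : ℕ} (h : m ≤ n) : stage.map (homOfLE h) ≫ toBody n = toBody m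
  isColimit : IsColimit (Cocone.mk Y
    { app := toBody
      naturality := fun _ _ φ =>
        (toBody_naturality (leOfHom φ)).trans (Category.comp_id _).symm } : Cocone stage)
  base_toBody : base.hom ≫ toBody 0 = f

namespace CellStr

open TopCat

variable {X Y Z : TopCat.{u}} {f : X ⟶ Y} {g : Y ⟶ Z}

/-- The set of all cells of shape `S^{d-1} ⟶ D^d` of a relative cell complex. -/
abbrev Cell (σ : CellStr f) (d : ℕ) : Type u := Σ n, (σ.stratum n).cells d

/-- The characteristic map of a cell, with values in the body of the complex. -/
noncomputable def charMap (σ : CellStr f) {d : ℕ} (s : σ.Cell d) : 𝔻 d ⟶ Y :=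
  (σ.stratum s.1).char s.2 ≫ σ.toBody (s.1 + 1)

/-- `ρ` is a composite of `σ` followed by `τ`: the cells of `ρ` are the cells of `σ` together with
the cells of `τ`, glued into the body in the same way. By properness each cell lies in the lowest
possible stratum of `ρ`, so there is no choice for the strata of `ρ`. -/
def IsComposite (σ : CellStr f) (τ : CellStr g) (ρ : CellStr (f ≫ g)) : Prop :=
  ∃ e : ∀ d, σ.Cell d ⊕ τ.Cell d ≃ ρ.Cell d,
    (∀ d (s : σ.Cell d), ρ.charMap (e d (Sum.inl s)) = σ.charMap s ≫ g) ∧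
    (∀ d (t : τ.Cell d), ρ.charMap (e d (Sum.inr t)) = τ.charMap t)

end CellStr

/-- Relative cell complexes. -/
structure CellCx : Type (u + 1) where
  boundary : TopCat.{u}
  body : TopCat.{u}
  map : boundary ⟶ body
  str : CellStr map

namespace CellCx

/-- A morphism of relative cell complexes: a sequence of morphisms of strata `(f_n, p_n)` such that
`f_{n+1}` is the map of bodies induced by `(f_n, p_n)`. The maps of boundaries and of bodies are
those induced by the sequence. -/
@[ext]
structure Hom (A B : CellCx.{u}) where
  left : A.boundary ⟶ B.boundary
  right : A.body ⟶ B.body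
  stageMap (n : ℕ) : A.str.stage.obj n ⟶ B.str.stage.obj n
  cellMap (n d : ℕ) : (A.str.stratum n).cells d → (B.str.stratum n).cells d
  attach_stageMap (n d : ℕ) (s : (A.str.stratum n).cells d) :
    (A.str.stratum n).attach s ≫ stageMap n = (B.str.stratum n).attach (cellMap n d s)
  char_stageMap (n d : ℕ) (s : (A.str.stratum n).cells d) :
    (A.str.stratum n).char s ≫ stageMap (n + 1) = (B.str.stratum n).char (cellMap n d s)
  stageMap_succ (n : ℕ) :
    A.str.stage.map (homOfLE n.le_succ) ≫ stageMap (n + 1) =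
      stageMap n ≫ B.str.stage.map (homOfLE n.le_succ)
  base_stageMap : A.str.base.hom ≫ stageMap 0 = left ≫ B.str.base.hom
  toBody_right (n : ℕ) : A.str.toBody n ≫ right = stageMap n ≫ B.str.toBody n

instance : Category CellCx.{u} where
  Hom := Hom
  id A :=
    { left := 𝟙 _
      right := 𝟙 _
      stageMap := fun _ => 𝟙 _
      cellMap := fun _ _ s => s
      attach_stageMap := by simp
      char_stageMap := by simp
      stageMap_succ := by simp
      base_stageMap := by simp
      toBody_right := by simp }
  comp φ ψ :=
    { left := φ.left ≫ ψ.left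
      right := φ.right ≫ ψ.right
      stageMap := fun n => φ.stageMap n ≫ ψ.stageMap n
      cellMap := fun n d s => ψ.cellMap n d (φ.cellMap n d s)
      attach_stageMap := fun n d s => by
        rw [reassoc_of% φ.attach_stageMap, ψ.attach_stageMap]
      char_stageMap := fun n d s => by
        rw [reassoc_of% φ.char_stageMap, ψ.char_stageMap]
      stageMap_succ := fun n => by
        rw [reassoc_of% φ.stageMap_succ, ψ.stageMap_succ, Category.assoc]
      base_stageMap := by
        rw [reassoc_of% φ.base_stageMap, ψ.base_stageMap, Category.assoc]
      toBody_right := fun n => by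
        rw [reassoc_of% φ.toBody_right, ψ.toBody_right, Category.assoc] }
  id_comp _ := by ext <;> simp
  comp_id _ := by ext <;> simp
  assoc _ _ _ := by ext <;> simp

/-- The forgetful functor from relative cell complexes to arrows of spaces. -/
def U : CellCx.{u} ⥤ Arrow TopCat.{u} where
  obj A := Arrow.mk A.map
  map {A B} φ := Arrow.homMk φ.left φ.right (by
    have h : A.str.base.hom ≫ A.str.toBody 0 ≫ φ.right =
        φ.left ≫ B.str.base.hom ≫ B.str.toBody 0 := by
      rw [φ.toBody_right, reassoc_of% φ.base_stageMap]
    rw [B.str.base_toBody, ← Category.assoc, A.str.base_toBody] at h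
    exact h.symm)
  map_id _ := rfl
  map_comp _ _ := rfl

end CellCx

/-! ### The canonical complex on a single cell -/

namespace SingleCell

open TopCat

/-- The stages `S^{d-1} ⟶ D^d = D^d = ⋯`. -/
noncomputable abbrev obj (d : ℕ) : ℕ → TopCat.{u}
  | 0 => ∂𝔻 d
  | _ + 1 => 𝔻 d

/-- The transition maps between the stages. -/
noncomputable abbrev step (d : ℕ) : ∀ n, obj.{u} d n ⟶ obj.{u} d (n + 1)
  | 0 => diskBoundaryInclusion d
  | _ + 1 => 𝟙 (𝔻 d)

/-- The inclusions of the stages into the body. -/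
noncomputable abbrev toBody (d : ℕ) : ∀ n, obj.{u} d n ⟶ 𝔻 d
  | 0 => diskBoundaryInclusion d
  | _ + 1 => 𝟙 (𝔻 d)

lemma step_toBody (d : ℕ) : ∀ n, step.{u} d n ≫ toBody d (n + 1) = toBody d n
  | 0 => Category.comp_id _
  | _ + 1 => Category.comp_id _

/-- The cells in the stratum `n`: a single one, of shape `d`, for `n = 0`. -/
inductive Cells (d : ℕ) : ℕ → ℕ → Type u
  | mk : Cells d 0 d

/-- The sequence of stages as a functor. -/
noncomputable def stage (d : ℕ) : ℕ ⥤ TopCat.{u} := Functor.ofSequence (step d)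

lemma stage_succ (d n : ℕ) : (stage.{u} d).map (homOfLE n.le_succ) = step d n :=
  Functor.ofSequence_map_homOfLE_succ _ _

/-- The attaching maps. -/
noncomputable def attach {d : ℕ} : ∀ {n e : ℕ}, Cells.{u} d n e → (∂𝔻 e ⟶ obj.{u} d n)
  | _, _, .mk => 𝟙 (∂𝔻 d)

/-- The characteristic maps. -/
noncomputable def char {d : ℕ} : ∀ {n e : ℕ}, Cells.{u} d n e → (𝔻 e ⟶ obj.{u} d (n + 1))
  | _, _, .mk => 𝟙 (𝔻 d)

lemma attach_step {d n e : ℕ} (s : Cells.{u} d n e) :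
    attach s ≫ step d n = diskBoundaryInclusion e ≫ char s := by
  cases s
  exact (Category.id_comp _).trans (Category.comp_id _).symm

lemma isPushout (d n : ℕ) : IsPushout
    (Limits.Sigma.map fun s : Σ e, Cells.{u} d n e => diskBoundaryInclusion.{u} s.1)
    (Limits.Sigma.desc fun s : Σ e, Cells d n e => attach s.2)
    (Limits.Sigma.desc fun s : Σ e, Cells d n e => char s.2) (step.{u} d n) := by
  refine ⟨⟨?_⟩, ⟨PushoutCocone.IsColimit.mk _
    (fun c => match n, c with
      | 0, c => Limits.Sigma.ι (fun s : Σ e, Cells.{u} d 0 e => disk.{u} s.1) ⟨d, .mk⟩ ≫ c.inl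
      | _ + 1, c => c.inr) ?_ ?_ ?_⟩⟩
  · ext1 s
    simp [attach_step]
  · intro c
    ext1 ⟨e, s⟩
    cases s
    simp [char]
  · intro c
    cases n with
    | zero =>
      have h := Limits.Sigma.ι (fun s : Σ e, Cells.{u} d 0 e => diskBoundary.{u} s.1) ⟨d, .mk⟩ ≫= c.condition
      simp [attach] at h
      exact h
    | succ n => exact Category.id_comp _
  · intro c m h₁ h₂
    cases n with
    | zero =>
      have h := Limits.Sigma.ι (fun s : Σ e, Cells.{u} d 0 e => disk.{u} s.1) ⟨d, .mk⟩ ≫= h₁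
      simp [char] at h
      exact h
    | succ n => exact (Category.id_comp _).symm.trans h₂

/-- The height one complex structure with a single cell on `S^{d-1} ⟶ D^d`. -/
noncomputable def str (d : ℕ) : CellStr (diskBoundaryInclusion.{u} d) where
  stage := stage d
  base := Iso.refl _
  stratum n :=
    { cells := Cells d n
      attach := attach
      char := char
      isPushout := by rw [stage_succ]; exact isPushout d n }
  proper := by
    rintro n e ⟨⟩ m h
    exact absurd h (Nat.not_lt_zero m)
  toBody := toBody d
  toBody_naturality {m n} h := by
    induction n, h using Nat.le_induction with
    | base => exact (congrArg (· ≫ toBody d m) ((stage d).map_id m)).trans (Category.id_comp _)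
    | succ n h ih =>
      rw [← homOfLE_comp h n.le_succ, Functor.map_comp, stage_succ]
      exact (Category.assoc _ _ _).trans
        ((congrArg ((stage d).map (homOfLE h) ≫ ·) (step_toBody d n)).trans ih)
  isColimit :=
    { desc := fun c => c.ι.app 1
      fac := fun c n => by
        cases n with
        | zero =>
          have h := c.w (homOfLE (Nat.le_succ 0))
          rw [stage_succ] at h
          exact h
        | succ n =>
          have h : ∀ k, c.ι.app (k + 1) = c.ι.app 1 := by
            intro k
            induction k with
            | zero => rfl
            | succ k ih =>
              have h := c.w (homOfLE (Nat.le_succ (k + 1)))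
              rw [stage_succ] at h
              exact ((Category.id_comp _).symm.trans h).trans ih
          exact (Category.id_comp _).trans (h n).symm
      uniq := fun c m h => (Category.id_comp _).symm.trans (h 1) }
  base_toBody := Category.id_comp _

end SingleCell

namespace CellCx

open TopCat

/-- The canonical functor `J ⥤ CellCx`, sending a generating map to its single-cell complex. -/
noncomputable def unit : Discrete ℕ ⥤ CellCx.{u} :=
  Discrete.functor fun d => ⟨∂𝔻 d, 𝔻 d, diskBoundaryInclusion d, SingleCell.str d⟩

/-- A functor from relative cell complexes to left maps preserves composition if it sends every
composite of two relative cell complexes to the composite of the corresponding left maps. -/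
def PreservesComposition {W : AWFS TopCat.{u}} (F : CellCx.{u} ⥤ W.LMap) : Prop :=
  ∀ {X Y Z : TopCat.{u}} {f : X ⟶ Y} {g : Y ⟶ Z}
    (σ : CellStr f) (τ : CellStr g) (ρ : CellStr (f ≫ g)), σ.IsComposite τ ρ →
    W.IsComposite (F.obj ⟨X, Y, f, σ⟩) (F.obj ⟨Y, Z, g, τ⟩) (F.obj ⟨X, Z, f ≫ g, ρ⟩)

end CellCx

/-! ### Lifting left maps against free right maps -/

namespace AWFS

variable {C : Type w} [Category.{v} C] {W : AWFS C}

/-! A left map structure on `k` supplies a canonical filler for every square from `k` to a free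
right map `R h`. A map into `M h` is algebraic if it is the canonical filler of the square it spans;
it is then determined by its restriction along `k` and its projection along `rho h`. Algebraic maps
are stable under `M.map` (naturality of `μ`), `mul` (associativity) and `comul` (distributive law).

Given structures on the generating maps, a map from the body of a complex on `f` into `M h` is
cellular if it is algebraic on every cell. Working stratum by stratum, every square from `f` to `R
h` has exactly one cellular filler (`exists_isCellular`, `IsCellular.eq_of`). The cellular filler of
the unit square is the coalgebra structure on `f`. Coassociativity, naturality and compatibility
with composition each compare two cellular maps with the same restriction and projection.

Conversely, let `F'` be a functor as required. To see that the structure of `F' A` is algebraic on a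
cell of stratum `n`, cut `A` at stage `n`. In the tail the cell lies in the lowest stratum, so it is
the image of a morphism from a single-cell complex, and naturality makes the structure of the tail
algebraic on it. The composition formula leads from the tail to `A` by `M.map` and `mul`, which
preserve algebraic maps. So `F'` is determined on objects, and on morphisms because left maps are
faithful over arrows.

Concatenating two complexes gives a sequence of length ω + ω, so composites need a rearrangement. A
complex is a cell system, in which cells are only well-founded; cell systems compose by placing the
second set of cells after the first. Compactness of spheres shows that each boundary meets finitely
many open cells (`finite_boundaryCells`). Hence every cell has a finite height, the lowest stage to
which it can be attached, and sorting the cells by height gives a proper complex. -/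

lemma lam_comul (h : Arrow C) : W.lam h ≫ W.comul h = W.lam (W.L.obj h) := by
  have h₁ : (W.δ.app h).left = 𝟙 h.left :=
    (Category.comp_id _).symm.trans (congrArg CommaMorphism.left (W.left_counit h))
  have h₂ : (W.δ.app h).left ≫ W.lam (W.L.obj h) = W.lam h ≫ W.comul h := Arrow.w (W.δ.app h)
  rw [h₁] at h₂
  exact h₂.symm.trans (Category.id_comp _)

lemma comul_rho (h : Arrow C) : W.comul h ≫ W.rho (W.L.obj h) = 𝟙 (W.M.obj h) :=
  congrArg CommaMorphism.right (W.left_counit h)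

lemma map_η_mul (h : Arrow C) : W.M.map (W.η.app h) ≫ W.mul h = 𝟙 (W.M.obj h) :=
  congrArg CommaMorphism.left (W.right_unit h)

lemma map_μ_mul (h : Arrow C) :
    W.M.map (W.μ.app h) ≫ W.mul h = W.mul (W.R.obj h) ≫ W.mul h :=
  congrArg CommaMorphism.left (W.assoc h)

lemma μ_app_right (h : Arrow C) : (W.μ.app h).right = 𝟙 h.right :=
  (Category.id_comp _).symm.trans (congrArg CommaMorphism.right (W.left_unit h))

namespace LeftStr

variable {S D : C} {k : S ⟶ D} (β : W.LeftStr k) {h h' : Arrow C}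

@[ext]
lemma ext {β γ : W.LeftStr k} (e : β.str = γ.str) : β = γ := by
  have : β.a = γ.a := Arrow.hom_ext _ _ (β.a_left.trans γ.a_left.symm) e
  cases β
  cases γ
  cases this
  rfl

/-- The filler, provided by a left map structure on `k`, of a square from `k` to `R h`. -/
def lift (q : Arrow.mk k ⟶ W.R.obj h) : D ⟶ W.M.obj h :=
  β.str ≫ W.M.map q ≫ W.mul h

lemma comp_lift (q : Arrow.mk k ⟶ W.R.obj h) : k ≫ β.lift q = q.left := by
  have e : W.lam (Arrow.mk k) ≫ W.M.map q = q.left ≫ W.lam (W.R.obj h) :=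
    (W.lam_naturality q).symm
  rw [lift, reassoc_of% β.comp_str, reassoc_of% e, PreAWFS.lam_mul]
  exact Category.comp_id _

lemma lift_rho (q : Arrow.mk k ⟶ W.R.obj h) : β.lift q ≫ W.rho h = q.right := by
  have e : W.M.map q ≫ W.rho (W.R.obj h) = W.rho (Arrow.mk k) ≫ q.right := W.rho_naturality q
  rw [lift, Category.assoc, Category.assoc, PreAWFS.mul_rho, e, reassoc_of% β.str_rho]

/-- The square from `k` to `R h` with diagonal `x`. -/
def square (k : S ⟶ D) (x : D ⟶ W.M.obj h) : Arrow.mk k ⟶ W.R.obj h :=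
  Arrow.homMk (k ≫ x) (x ≫ W.rho h) (Category.assoc _ _ _)

/-- The diagonal `x` of a square from `k` to `R h` is algebraic if it is the filler of that square
provided by the left map structure on `k`. -/
def IsAlg (x : D ⟶ W.M.obj h) : Prop := β.lift (square k x) = x

variable {β}

lemma isAlg_lift (q : Arrow.mk k ⟶ W.R.obj h) : β.IsAlg (β.lift q) := by
  have : square k (β.lift q) = q := Arrow.hom_ext _ _ (β.comp_lift q) (β.lift_rho q)
  rw [IsAlg, this]

lemma IsAlg.eq_of {x y : D ⟶ W.M.obj h} (hx : β.IsAlg x) (hy : β.IsAlg y)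
    (h₁ : k ≫ x = k ≫ y) (h₂ : x ≫ W.rho h = y ≫ W.rho h) : x = y := by
  have : square k x = square k y := Arrow.hom_ext _ _ h₁ h₂
  rw [← hx, ← hy, this]

/-- The structure map spans the unit square `η`, so this is the right unit law of the monad. -/
lemma isAlg_str : β.IsAlg β.str := by
  have : square k β.str = W.η.app (Arrow.mk k) := Arrow.hom_ext _ _ β.comp_str β.str_rho
  rw [IsAlg, lift, this, map_η_mul]
  exact Category.comp_id _

lemma IsAlg.map {x : D ⟶ W.M.obj h} (hx : β.IsAlg x) (φ : h ⟶ h') :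
    β.IsAlg (x ≫ W.M.map φ) := by
  have : square k (x ≫ W.M.map φ) = square k x ≫ W.R.map φ :=
    Arrow.hom_ext _ _ (Category.assoc _ _ _).symm
      (show (x ≫ W.M.map φ) ≫ W.rho h' = (x ≫ W.rho h) ≫ φ.right by
        rw [Category.assoc, Category.assoc, W.rho_naturality])
  rw [IsAlg, this, lift, W.M.map_comp, Category.assoc, mul_naturality]
  conv_rhs => rw [← hx, lift]
  simp only [Category.assoc]

lemma IsAlg.mul {x : D ⟶ W.M.obj (W.R.obj h)} (hx : β.IsAlg x) : β.IsAlg (x ≫ W.mul h) := by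
  have : square k (x ≫ W.mul h) = square k x ≫ W.μ.app h :=
    Arrow.hom_ext _ _ (Category.assoc _ _ _).symm
      (show (x ≫ W.mul h) ≫ W.rho h = (x ≫ W.rho (W.R.obj h)) ≫ (W.μ.app h).right by
        rw [Category.assoc, Category.assoc, PreAWFS.mul_rho, μ_app_right]
        exact congrArg (x ≫ ·) (Category.comp_id _).symm)
  rw [IsAlg, this, lift, W.M.map_comp, Category.assoc, map_μ_mul]
  conv_rhs => rw [← hx, lift]
  simp only [Category.assoc]

/-- The square spanned by `x ≫ comul` is that of `x`, transported by `L` and followed by `Δ`. The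
distributive law and coassociativity of `β` then identify the two fillers. -/
lemma IsAlg.comul {x : D ⟶ W.M.obj h} (hx : β.IsAlg x) : β.IsAlg (x ≫ W.comul h) := by
  have : square k (x ≫ W.comul h) = β.a ≫ W.L.map (square k x) ≫ W.Δ h := by
    refine Arrow.hom_ext _ _ ?_ ?_
    · change k ≫ x ≫ W.comul h = β.a.left ≫ (k ≫ x) ≫ W.comul h
      rw [β.a_left, Category.assoc]
      exact (Category.id_comp _).symm
    · change (x ≫ W.comul h) ≫ W.rho (W.L.obj h) = β.lift (square k x)
      rw [hx, Category.assoc, comul_rho]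
      exact Category.comp_id _
  rw [IsAlg, this, lift, W.M.map_comp, W.M.map_comp]
  conv_rhs => rw [← hx, lift]
  simp only [Category.assoc]
  rw [distrib, ← Category.assoc (W.M.map (square k x)), comul_naturality, Category.assoc,
    reassoc_of% β.str_comul]

end LeftStr

/-! ### Left maps over a prescribed arrow -/

lemma LMap.exists_leftStr (a : W.LMap) {X Y : C} {f : X ⟶ Y} (e : a.A = Arrow.mk f) :
    ∃ α : W.LeftStr f, α.toLMap = a := by
  obtain ⟨A, a, h₁, h₂⟩ := a
  change A = Arrow.mk f at e
  subst e
  exact ⟨⟨a, h₁, h₂⟩, rfl⟩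

lemma LeftStr.toLMap_injective {X Y : C} {f : X ⟶ Y} {α β : W.LeftStr f}
    (e : α.toLMap = β.toLMap) : α = β := by
  have h : HEq α.toLMap.a β.toLMap.a := by rw [e]
  have h' : α.a = β.a := eq_of_heq h
  exact LeftStr.ext (congrArg CommaMorphism.right h')

lemma IsComposite.eq_comp {X Y Z : C} {f : X ⟶ Y} {g : Y ⟶ Z} {α : W.LeftStr f}
    {β : W.LeftStr g} {γ : W.LeftStr (f ≫ g)}
    (H : W.IsComposite α.toLMap β.toLMap γ.toLMap) : γ = α.comp β := by
  -- Case analysis needs variable indices; the equations recorded here recover the arrows and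
  -- structures afterwards.
  generalize ha : α.toLMap = a at H
  generalize hb : β.toLMap = b at H
  generalize hc : γ.toLMap = c at H
  obtain ⟨α', β'⟩ := H
  rename_i f' g'
  have h₁ : Arrow.mk f = Arrow.mk f' := congrArg Comonad.Coalgebra.A ha
  have h₂ : Arrow.mk g = Arrow.mk g' := congrArg Comonad.Coalgebra.A hb
  cases h₁
  cases h₂
  cases LeftStr.toLMap_injective ha
  cases LeftStr.toLMap_injective hb
  exact LeftStr.toLMap_injective hc

end AWFS

/-! ### The left map structure of a relative cell complex -/

namespace Stratum

open TopCat

variable {X X' : TopCat.{u}} {i : X ⟶ X'} (S : Stratum i)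

lemma attach_comp {d : ℕ} (s : S.cells d) :
    S.attach s ≫ i = diskBoundaryInclusion d ≫ S.char s := by
  have h := Limits.Sigma.ι (fun s : Σ d, S.cells d => diskBoundary.{u} s.1) ⟨d, s⟩ ≫=
    S.isPushout.w
  simp at h
  exact h.symm

variable {S} in
lemma hom_ext {T : TopCat.{u}} {a b : X' ⟶ T} (h : i ≫ a = i ≫ b)
    (h' : ∀ d (s : S.cells d), S.char s ≫ a = S.char s ≫ b) : a = b := by
  refine S.isPushout.hom_ext ?_ h
  ext1 ⟨d, s⟩
  simpa using h' d s

lemma exists_desc {T : TopCat.{u}} (a : X ⟶ T) (x : ∀ d, S.cells d → (𝔻 d ⟶ T))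
    (h : ∀ d (s : S.cells d), S.attach s ≫ a = diskBoundaryInclusion d ≫ x d s) :
    ∃ b : X' ⟶ T, i ≫ b = a ∧ ∀ d (s : S.cells d), S.char s ≫ b = x d s := by
  have w : Limits.Sigma.map (fun s : Σ d, S.cells d => diskBoundaryInclusion.{u} s.1) ≫
      Limits.Sigma.desc (fun s : Σ d, S.cells d => x s.1 s.2) =
      Limits.Sigma.desc (fun s : Σ d, S.cells d => S.attach s.2) ≫ a := by
    ext1 ⟨d, s⟩
    simpa using (h d s).symm
  refine ⟨S.isPushout.desc _ a w, S.isPushout.inr_desc _ _ _, fun d s => ?_⟩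
  have e₁ : Limits.Sigma.ι (fun s : Σ d, S.cells d => disk.{u} s.1) ⟨d, s⟩ ≫
      Limits.Sigma.desc (fun s : Σ d, S.cells d => S.char s.2) = S.char s :=
    Limits.Sigma.ι_desc _ _
  rw [← e₁, Category.assoc, S.isPushout.inl_desc _ a w]
  exact Limits.Sigma.ι_desc _ _

end Stratum

namespace CellStr

open TopCat

variable {X Y Z : TopCat.{u}} {f : X ⟶ Y} {g : Y ⟶ Z} (σ : CellStr f)

lemma step_toBody (n : ℕ) :
    σ.stage.map (homOfLE n.le_succ) ≫ σ.toBody (n + 1) = σ.toBody n :=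
  σ.toBody_naturality n.le_succ

lemma base_inv_comp : σ.base.inv ≫ f = σ.toBody 0 :=
  σ.base.inv_comp_eq.mpr σ.base_toBody.symm

lemma boundary_charMap {n d : ℕ} (s : (σ.stratum n).cells d) :
    diskBoundaryInclusion d ≫ σ.charMap ⟨n, s⟩ = (σ.stratum n).attach s ≫ σ.toBody n := by
  rw [charMap, ← Category.assoc, ← Stratum.attach_comp, Category.assoc, step_toBody]

variable {σ} in
lemma body_hom_ext {T : TopCat.{u}} {a b : Y ⟶ T}
    (h : ∀ n, σ.toBody n ≫ a = σ.toBody n ≫ b) : a = b :=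
  σ.isColimit.hom_ext h

lemma exists_bodyDesc {T : TopCat.{u}} (a : ∀ n, σ.stage.obj n ⟶ T)
    (h : ∀ n, σ.stage.map (homOfLE n.le_succ) ≫ a (n + 1) = a n) :
    ∃ b : Y ⟶ T, ∀ n, σ.toBody n ≫ b = a n := by
  have h' {m n : ℕ} (e : m ≤ n) : σ.stage.map (homOfLE e) ≫ a n = a m := by
    induction n, e using Nat.le_induction with
    | base => exact (congrArg (· ≫ a m) (σ.stage.map_id m)).trans (Category.id_comp _)
    | succ n e ih =>
      rw [← homOfLE_comp e n.le_succ, Functor.map_comp, Category.assoc, h, ih]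
  exact ⟨σ.isColimit.desc (Cocone.mk T
    { app := a
      naturality := fun _ _ φ => (h' (leOfHom φ)).trans (Category.comp_id _).symm }),
    σ.isColimit.fac _⟩

/-! ### Cellular maps and the structure they define -/

variable {W : AWFS TopCat.{u}} (κ : ∀ d, W.LeftStr (diskBoundaryInclusion.{u} d))
  {h h' : Arrow TopCat.{u}}

/-- A map into a free right map is cellular if it is algebraic on each cell. -/
def IsCellular (t : Y ⟶ W.M.obj h) : Prop :=
  ∀ d (s : σ.Cell d), (κ d).IsAlg (σ.charMap s ≫ t)

variable {σ κ}

lemma IsCellular.map {t : Y ⟶ W.M.obj h} (ht : σ.IsCellular κ t) (φ : h ⟶ h') :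
    σ.IsCellular κ (t ≫ W.M.map φ) := fun d s => (ht d s).map φ

lemma IsCellular.mul {t : Y ⟶ W.M.obj (W.R.obj h)} (ht : σ.IsCellular κ t) :
    σ.IsCellular κ (t ≫ W.mul h) := fun d s => (ht d s).mul

lemma IsCellular.comul {t : Y ⟶ W.M.obj h} (ht : σ.IsCellular κ t) :
    σ.IsCellular κ (t ≫ W.comul h) := fun d s => (ht d s).comul

/-- By induction on the stage, the maps agree on the boundary of each new cell, and an algebraic map
is fixed by its boundary values and projection. -/
lemma IsCellular.eq_of {t t' : Y ⟶ W.M.obj h} (ht : σ.IsCellular κ t) (ht' : σ.IsCellular κ t')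
    (h₁ : f ≫ t = f ≫ t') (h₂ : t ≫ W.rho h = t' ≫ W.rho h) : t = t' := by
  refine σ.body_hom_ext fun n => ?_
  induction n with
  | zero =>
    rw [← cancel_epi σ.base.hom, ← Category.assoc, ← Category.assoc, σ.base_toBody, h₁]
  | succ n ih =>
    refine (σ.stratum n).hom_ext ?_ fun d s => ?_
    · rw [← Category.assoc, ← Category.assoc, step_toBody, ih]
    · rw [← Category.assoc, ← Category.assoc]
      change σ.charMap ⟨n, s⟩ ≫ t = σ.charMap ⟨n, s⟩ ≫ t'
      refine (ht d ⟨n, s⟩).eq_of (ht' d ⟨n, s⟩) ?_ ?_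
      · rw [← Category.assoc, ← Category.assoc, boundary_charMap, Category.assoc, Category.assoc, ih]
      · rw [Category.assoc, h₂, Category.assoc]

variable (σ κ)

lemma exists_isCellular (q : Arrow.mk f ⟶ W.R.obj h) :
    ∃ t : Y ⟶ W.M.obj h, f ≫ t = q.left ∧ t ≫ W.rho h = q.right ∧ σ.IsCellular κ t := by
  have hq : q.left ≫ W.rho h = f ≫ q.right := Arrow.w q
  -- The recursion carries the projection equation, without which the squares to be filled on the
  -- next cells could not be formed.
  have step (n : ℕ) (a : { a : σ.stage.obj n ⟶ W.M.obj h // a ≫ W.rho h = σ.toBody n ≫ q.right }) :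
      ∃ b : { b : σ.stage.obj (n + 1) ⟶ W.M.obj h // b ≫ W.rho h = σ.toBody (n + 1) ≫ q.right },
        σ.stage.map (homOfLE n.le_succ) ≫ b.1 = a.1 ∧
        ∀ d (s : (σ.stratum n).cells d), (κ d).IsAlg ((σ.stratum n).char s ≫ b.1) := by
    let Q (d : ℕ) (s : (σ.stratum n).cells d) :
        Arrow.mk (diskBoundaryInclusion d) ⟶ W.R.obj h :=
      Arrow.homMk ((σ.stratum n).attach s ≫ a.1) (σ.charMap ⟨n, s⟩ ≫ q.right) (by
        change ((σ.stratum n).attach s ≫ a.1) ≫ W.rho h =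
          diskBoundaryInclusion d ≫ σ.charMap ⟨n, s⟩ ≫ q.right
        rw [Category.assoc, a.2, ← Category.assoc, ← boundary_charMap, Category.assoc])
    obtain ⟨b, hb, hb'⟩ := (σ.stratum n).exists_desc a.1 (fun d s => (κ d).lift (Q d s))
      (fun d s => ((κ d).comp_lift (Q d s)).symm)
    refine ⟨⟨b, (σ.stratum n).hom_ext ?_ fun d s => ?_⟩, hb, fun d s => ?_⟩
    · rw [← Category.assoc, hb, a.2, ← Category.assoc, step_toBody]
    · rw [← Category.assoc, hb', (κ d).lift_rho]
      exact Category.assoc _ _ _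
    · change (κ d).IsAlg ((σ.stratum n).char s ≫ b)
      rw [hb']
      exact AWFS.LeftStr.isAlg_lift _
  choose next hnext hnext' using step
  let a : ∀ n, { a : σ.stage.obj n ⟶ W.M.obj h // a ≫ W.rho h = σ.toBody n ≫ q.right } :=
    fun n => Nat.rec ⟨σ.base.inv ≫ q.left, by
      rw [Category.assoc, hq, ← σ.base_inv_comp, Category.assoc]⟩ next n
  obtain ⟨t, ht⟩ := σ.exists_bodyDesc (fun n => (a n).1) (fun n => hnext n (a n))
  refine ⟨t, ?_, σ.body_hom_ext fun n => ?_, fun d ⟨n, s⟩ => ?_⟩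
  · have e : f ≫ t = σ.base.hom ≫ σ.toBody 0 ≫ t := by rw [← Category.assoc, σ.base_toBody]
    rw [e, ht]
    exact σ.base.hom_inv_id_assoc _
  · rw [← Category.assoc, ht, (a n).2]
  · rw [charMap, Category.assoc, ht]
    exact hnext' n (a n) d s

/-- The structure map of the left map underlying a relative cell complex. -/
noncomputable def cellularStr : Y ⟶ W.M.obj (Arrow.mk f) :=
  (σ.exists_isCellular κ (W.η.app (Arrow.mk f))).choose

lemma comp_cellularStr : f ≫ σ.cellularStr κ = W.lam (Arrow.mk f) :=
  (σ.exists_isCellular κ (W.η.app (Arrow.mk f))).choose_spec.1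

lemma cellularStr_rho : σ.cellularStr κ ≫ W.rho (Arrow.mk f) = 𝟙 Y :=
  (σ.exists_isCellular κ (W.η.app (Arrow.mk f))).choose_spec.2.1

lemma isCellular_cellularStr : σ.IsCellular κ (σ.cellularStr κ) :=
  (σ.exists_isCellular κ (W.η.app (Arrow.mk f))).choose_spec.2.2

/-- The coalgebra square of a relative cell complex. -/
noncomputable def cellularSquare : Arrow.mk f ⟶ W.L.obj (Arrow.mk f) :=
  Arrow.homMk (𝟙 X) (σ.cellularStr κ)
    ((Category.id_comp _).trans (σ.comp_cellularStr κ).symm)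

/-- Both sides are cellular, restrict to `lam (L f)` on `X` and project to the structure map itself.
-/
lemma cellularStr_comul : σ.cellularStr κ ≫ W.comul (Arrow.mk f) =
    σ.cellularStr κ ≫ W.M.map (σ.cellularSquare κ) := by
  refine (σ.isCellular_cellularStr κ).comul.eq_of ((σ.isCellular_cellularStr κ).map _) ?_ ?_
  · rw [← Category.assoc, ← Category.assoc, comp_cellularStr, AWFS.lam_comul,
      ← W.lam_naturality]
    exact (Category.id_comp _).symm
  · rw [Category.assoc, Category.assoc, AWFS.comul_rho, W.rho_naturality, ← Category.assoc]
    erw [cellularStr_rho]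
    exact (Category.comp_id _).trans (Category.id_comp _).symm

/-- The left map structure of a relative cell complex, given left map structures on the
generating maps. -/
noncomputable def leftStr : W.LeftStr f where
  a := σ.cellularSquare κ
  counit := Arrow.hom_ext _ _ (Category.comp_id _) (σ.cellularStr_rho κ)
  coassoc := by
    refine Arrow.hom_ext _ _ ?_ (σ.cellularStr_comul κ)
    have h : (W.δ.app (Arrow.mk f)).left = 𝟙 X :=
      (Category.comp_id _).symm.trans (congrArg CommaMorphism.left (W.left_counit (Arrow.mk f)))
    change 𝟙 X ≫ (W.δ.app (Arrow.mk f)).left = 𝟙 X ≫ 𝟙 X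
    rw [h]

variable {σ κ}

/-- Any left map structure already has the restriction and projection of the unit square, so
cellularity alone singles it out. -/
lemma leftStr_eq {α : W.LeftStr f} (hα : σ.IsCellular κ α.str) : σ.leftStr κ = α :=
  AWFS.LeftStr.ext ((σ.isCellular_cellularStr κ).eq_of hα
    ((σ.comp_cellularStr κ).trans α.comp_str.symm)
    ((σ.cellularStr_rho κ).trans α.str_rho.symm))

lemma isCellular_leftStr : σ.IsCellular κ (σ.leftStr κ).str := σ.isCellular_cellularStr κ

lemma leftStr_naturality {X' Y' : TopCat.{u}} {f' : X' ⟶ Y'} {σ' : CellStr f'}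
    (q : Arrow.mk f ⟶ Arrow.mk f')
    (hq : ∀ d (s : σ.Cell d), ∃ s', σ.charMap s ≫ q.right = σ'.charMap s') :
    (σ.leftStr κ).str ≫ W.M.map q = q.right ≫ (σ'.leftStr κ).str := by
  have w : q.left ≫ f' = f ≫ q.right := Arrow.w q
  refine (isCellular_leftStr.map q).eq_of (fun d s => ?_) ?_ ?_
  · obtain ⟨s', hs'⟩ := hq d s
    rw [← Category.assoc]
    refine (congrArg (fun x => (κ d).IsAlg (x ≫ (σ'.leftStr κ).str)) hs').mpr ?_
    exact isCellular_leftStr d s'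
  · rw [← Category.assoc, AWFS.LeftStr.comp_str, ← W.lam_naturality]
    refine (congrArg (q.left ≫ ·) (σ'.leftStr κ).comp_str.symm).trans ?_
    refine (Category.assoc _ _ _).symm.trans ((congrArg (· ≫ (σ'.leftStr κ).str) w).trans ?_)
    exact Category.assoc _ _ _
  · rw [Category.assoc, W.rho_naturality, ← Category.assoc, AWFS.LeftStr.str_rho]
    refine (Category.id_comp _).trans ((Category.comp_id _).symm.trans ?_)
    refine (congrArg (q.right ≫ ·) (σ'.leftStr κ).str_rho.symm).trans ?_
    exact (Category.assoc _ _ _).symm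

/-- The composite structure is cellular: on cells of `σ` it is the structure of `σ` followed by
`M.map`, on cells of `τ` that of `τ` followed by `M.map` and `mul`. -/
lemma IsComposite.leftStr_eq {τ : CellStr g} {ρ : CellStr (f ≫ g)} (H : σ.IsComposite τ ρ) :
    ρ.leftStr κ = (σ.leftStr κ).comp (τ.leftStr κ) := by
  obtain ⟨e, hσ, hτ⟩ := H
  refine CellStr.leftStr_eq fun d s => ?_
  change (κ d).IsAlg (_ ≫ (σ.leftStr κ).compStr (τ.leftStr κ))
  obtain ⟨s | s, rfl⟩ := (e d).surjective s
  · rw [hσ, Category.assoc, AWFS.LeftStr.comp_compStr', ← Category.assoc]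
    exact (isCellular_leftStr d s).map _
  · rw [hτ, AWFS.LeftStr.compStr, ← Category.assoc, ← Category.assoc]
    exact ((isCellular_leftStr d s).map _).mul

end CellStr

/-! ### Existence of the functor to left maps -/

namespace CellCx

open TopCat

variable {W : AWFS TopCat.{u}} (κ : ∀ d, W.LeftStr (diskBoundaryInclusion.{u} d))

lemma Hom.charMap_right {A B : CellCx.{u}} (φ : A ⟶ B) {n d : ℕ}
    (s : (A.str.stratum n).cells d) :
    A.str.charMap ⟨n, s⟩ ≫ Hom.right φ = B.str.charMap ⟨n, Hom.cellMap φ n d s⟩ := by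
  rw [CellStr.charMap, CellStr.charMap, Category.assoc, φ.toBody_right, ← Category.assoc,
    φ.char_stageMap]

/-- The functor from relative cell complexes to left maps determined by left map structures on the
generating maps. -/
noncomputable def toLMap : CellCx.{u} ⥤ W.LMap where
  obj A := (A.str.leftStr κ).toLMap
  map φ :=
    { f := U.map φ
      h := Arrow.hom_ext _ _ ((Category.id_comp _).trans (Category.comp_id _).symm)
        (CellStr.leftStr_naturality (U.map φ) fun _ s => ⟨_, Hom.charMap_right φ s.2⟩) }

lemma toLMap_preservesComposition : PreservesComposition (toLMap κ) := by
  intro X Y Z f g σ τ ρ H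
  change W.IsComposite (σ.leftStr κ).toLMap (τ.leftStr κ).toLMap (ρ.leftStr κ).toLMap
  rw [H.leftStr_eq]
  exact .mk _ _

lemma leftStr_singleCell (d : ℕ) : (SingleCell.str.{u} d).leftStr κ = κ d := by
  refine CellStr.leftStr_eq ?_
  rintro e ⟨n, ⟨⟩⟩
  have : (SingleCell.str d).charMap ⟨0, .mk⟩ = 𝟙 (𝔻 d) := Category.comp_id _
  rw [this, Category.id_comp]
  exact AWFS.LeftStr.isAlg_str

end CellCx

/-! ### Splitting a relative cell complex at a stage -/

namespace Stratum

open TopCat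

/-- The universal property of the body of a stratum, cell by cell. -/
lemma isPushout_of {X X' : TopCat.{u}} {i : X ⟶ X'} {cells : ℕ → Type u}
    {attach : ∀ {d : ℕ}, cells d → (∂𝔻 d ⟶ X)} {char : ∀ {d : ℕ}, cells d → (𝔻 d ⟶ X')}
    (w : ∀ d (s : cells d), attach s ≫ i = diskBoundaryInclusion d ≫ char s)
    (hom_ext : ∀ {T : TopCat.{u}} {a b : X' ⟶ T}, i ≫ a = i ≫ b →
      (∀ d (s : cells d), char s ≫ a = char s ≫ b) → a = b)
    (exists_desc : ∀ {T : TopCat.{u}} (a : X ⟶ T) (x : ∀ d, cells d → (𝔻 d ⟶ T)),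
      (∀ d (s : cells d), attach s ≫ a = diskBoundaryInclusion d ≫ x d s) →
      ∃ b : X' ⟶ T, i ≫ b = a ∧ ∀ d (s : cells d), char s ≫ b = x d s) :
    IsPushout
      (Limits.Sigma.map fun s : Σ d, cells d => diskBoundaryInclusion.{u} s.1)
      (Limits.Sigma.desc fun s : Σ d, cells d => attach s.2)
      (Limits.Sigma.desc fun s : Σ d, cells d => char s.2) i := by
  have key (c : PushoutCocone
      (Limits.Sigma.map fun s : Σ d, cells d => diskBoundaryInclusion.{u} s.1)
      (Limits.Sigma.desc fun s : Σ d, cells d => attach s.2)) :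
      ∃ b : X' ⟶ c.pt, i ≫ b = c.inr ∧ ∀ d (s : cells d), char s ≫ b =
        Limits.Sigma.ι (fun s : Σ d, cells d => disk.{u} s.1) ⟨d, s⟩ ≫ c.inl := by
    refine exists_desc c.inr _ fun d s => ?_
    have h := Limits.Sigma.ι (fun s : Σ d, cells d => diskBoundary.{u} s.1) ⟨d, s⟩ ≫= c.condition
    simp only [Sigma.ι_desc_assoc, Sigma.ι_map_assoc] at h
    exact h.symm
  choose b hb hb' using key
  refine ⟨⟨?_⟩, ⟨PushoutCocone.IsColimit.mk _ b (fun c => ?_) hb (fun c m h₁ h₂ => ?_)⟩⟩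
  · ext1 ⟨d, s⟩
    simpa using (w d s).symm
  · ext1 ⟨d, s⟩
    simpa using hb' c d s
  · refine hom_ext (h₂.trans (hb c).symm) fun d s => ?_
    rw [hb', ← h₁, Sigma.ι_desc_assoc]

end Stratum

namespace CellStr

open TopCat

variable {X Y Z : TopCat.{u}} {f : X ⟶ Y} {g : Y ⟶ Z} (σ : CellStr f)

lemma stage_map_comp {l m n : ℕ} (h : l ≤ m) (h' : m ≤ n) :
    σ.stage.map (homOfLE h) ≫ σ.stage.map (homOfLE h') = σ.stage.map (homOfLE (h.trans h')) := by
  rw [← Functor.map_comp]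
  rfl

lemma stage_map_self {m : ℕ} (h : m ≤ m) : σ.stage.map (homOfLE h) = 𝟙 _ := σ.stage.map_id m

/-- The stages from `n` on are cofinal: stage `k` maps to stage `n + k`, which gives the missing
components. -/
lemma existsUnique_tailDesc (n : ℕ) {T : TopCat.{u}} (a : ∀ m, σ.stage.obj (n + m) ⟶ T)
    (ha : ∀ {k l : ℕ} (h : k ≤ l),
      σ.stage.map (homOfLE (Nat.add_le_add_left h n)) ≫ a l = a k) :
    ∃! b : Y ⟶ T, ∀ m, σ.toBody (n + m) ≫ b = a m := by
  obtain ⟨b, hb⟩ := σ.exists_bodyDesc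
    (fun k => σ.stage.map (homOfLE (Nat.le_add_left k n)) ≫ a k) (fun k => by
      rw [← ha k.le_succ, ← Category.assoc, ← Category.assoc, stage_map_comp, stage_map_comp])
  refine ⟨b, fun k => ?_, fun b' hb' => σ.body_hom_ext fun k => ?_⟩
  · exact (hb (n + k)).trans (ha (Nat.le_add_left k n))
  · rw [hb, ← σ.toBody_naturality (Nat.le_add_left k n), Category.assoc, hb']

/-- The complex formed by the strata from the stage `n` on. -/
noncomputable def tail (n : ℕ) : CellStr (σ.toBody n) where
  stage := (Monotone.functor (f := fun m => n + m) fun _ _ h => Nat.add_le_add_left h n) ⋙ σ.stage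
  base := Iso.refl _
  stratum m := σ.stratum (n + m)
  proper m d s k h := σ.proper (n + m) d s (n + k) (Nat.add_lt_add_left h n)
  toBody m := σ.toBody (n + m)
  toBody_naturality h := σ.toBody_naturality (Nat.add_le_add_left h n)
  isColimit := IsColimit.ofExistsUnique fun c =>
    σ.existsUnique_tailDesc n c.ι.app fun h => c.w (homOfLE h)
  base_toBody := Category.id_comp _

/-- Here `p` and `q` stand for `min m n` and `min (m + 1) n`. As variables they can be substituted,
so that no casts between stages arise. Below `n` this is the original pushout; from `n` on there are
no cells and the map is an identity. -/
lemma head_isPushout {m n p q : ℕ} (hpq : p ≤ q) (hp : m < n → p = m) (hq : m < n → q = m + 1)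
    (h : ¬ m < n → p = q) :
    IsPushout
      (Limits.Sigma.map fun s : Σ d, { _s : (σ.stratum m).cells d // m < n } =>
        diskBoundaryInclusion.{u} s.1)
      (Limits.Sigma.desc fun s : Σ d, { _s : (σ.stratum m).cells d // m < n } =>
        (σ.stratum m).attach s.2.1 ≫ σ.stage.map (homOfLE (hp s.2.2).ge))
      (Limits.Sigma.desc fun s : Σ d, { _s : (σ.stratum m).cells d // m < n } =>
        (σ.stratum m).char s.2.1 ≫ σ.stage.map (homOfLE (hq s.2.2).ge))
      (σ.stage.map (homOfLE hpq)) := by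
  by_cases hmn : m < n
  · obtain rfl := hp hmn
    obtain rfl := hq hmn
    refine Stratum.isPushout_of
      (attach := fun s : { _s : (σ.stratum p).cells _ // p < n } =>
        (σ.stratum p).attach s.1 ≫ σ.stage.map (homOfLE (hp s.2).ge))
      (char := fun s : { _s : (σ.stratum p).cells _ // p < n } =>
        (σ.stratum p).char s.1 ≫ σ.stage.map (homOfLE (hq s.2).ge))
      (fun d s => ?_) (fun ha hab => ?_) (fun a x hx => ?_)
    · simp only [stage_map_self, Category.comp_id]
      exact (σ.stratum p).attach_comp s.1
    · exact (σ.stratum p).hom_ext ha fun d s => by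
        simpa only [stage_map_self, Category.comp_id] using hab d ⟨s, hmn⟩
    · simp only [stage_map_self, Category.comp_id] at hx ⊢
      obtain ⟨b, hb, hb'⟩ := (σ.stratum p).exists_desc a (fun d s => x d ⟨s, hmn⟩)
        (fun d s => hx d ⟨s, hmn⟩)
      exact ⟨b, hb, fun d s => hb' d s.1⟩
  · obtain rfl := h hmn
    refine Stratum.isPushout_of
      (attach := fun s : { _s : (σ.stratum m).cells _ // m < n } =>
        (σ.stratum m).attach s.1 ≫ σ.stage.map (homOfLE (hp s.2).ge))
      (char := fun s : { _s : (σ.stratum m).cells _ // m < n } =>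
        (σ.stratum m).char s.1 ≫ σ.stage.map (homOfLE (hq s.2).ge))
      (fun d s => (hmn s.2).elim) (fun ha _ => ?_) (fun a x hx => ?_)
    · simpa only [stage_map_self, Category.id_comp] using ha
    · exact ⟨a, by rw [stage_map_self, Category.id_comp], fun d s => (hmn s.2).elim⟩

/-- The complex formed by the strata below the stage `n`. -/
noncomputable def head (n : ℕ) : CellStr (σ.base.hom ≫ σ.stage.map (homOfLE n.zero_le)) where
  stage := (Monotone.functor (f := fun m => min m n) fun _ _ h => min_le_min_right n h) ⋙ σ.stage
  base := σ.base ≪≫ σ.stage.mapIso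
    ⟨homOfLE (Nat.zero_le _), homOfLE (min_le_left 0 n), rfl, rfl⟩
  stratum m :=
    { cells := fun d => { _s : (σ.stratum m).cells d // m < n }
      attach := fun s => (σ.stratum m).attach s.1 ≫
        σ.stage.map (homOfLE (min_eq_left s.2.le).ge)
      char := fun s => (σ.stratum m).char s.1 ≫
        σ.stage.map (homOfLE (min_eq_left (Nat.succ_le_of_lt s.2)).ge)
      isPushout := σ.head_isPushout (min_le_min_right n m.le_succ) (fun h => min_eq_left h.le)
        (fun h => min_eq_left (Nat.succ_le_of_lt h)) (fun h => by omega) }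
  proper m d s k h := by
    rintro ⟨(b : _ ⟶ σ.stage.obj (min k n)), hb⟩
    refine σ.proper m d s.1 k h ⟨b ≫ σ.stage.map (homOfLE (min_le_left k n)), ?_⟩
    have hb' : b ≫ σ.stage.map (homOfLE (min_le_min_right n h.le)) =
      (σ.stratum m).attach s.1 ≫ σ.stage.map (homOfLE (min_eq_left s.2.le).ge) := hb
    have h₁ := hb' =≫ σ.stage.map (homOfLE (min_le_left m n))
    clear hb
    rw [Category.assoc, Category.assoc, stage_map_comp, stage_map_comp, stage_map_self,
      Category.comp_id] at h₁
    rw [← h₁]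
    exact (Category.assoc _ _ _).trans (congrArg (b ≫ ·) (σ.stage_map_comp _ _))
  toBody m := σ.stage.map (homOfLE (min_le_right m n))
  toBody_naturality h := σ.stage_map_comp (min_le_min_right n h) _
  isColimit := IsColimit.ofExistsUnique fun c => by
    have hc {k l : ℕ} (h : k ≤ l) :
        σ.stage.map (homOfLE (min_le_min_right n h)) ≫ c.ι.app l = c.ι.app k :=
      c.w (homOfLE h)
    -- The sequence is constant from `n` on, so the component at `n` decides; the transition map
    -- identifies stage `n` with stage `min n n`.
    refine ⟨σ.stage.map (homOfLE (min_self n).ge) ≫ c.ι.app n, fun k => ?_, fun b hb => ?_⟩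
    · refine (Category.assoc _ _ _).symm.trans ?_
      refine (congrArg (· ≫ c.ι.app n) (σ.stage_map_comp (min_le_right k n) _)).trans ?_
      rcases le_total k n with h | h
      · exact hc h
      · rw [← hc h]
        refine (Category.assoc _ _ _).symm.trans ?_
        refine (congrArg (· ≫ c.ι.app k) ((σ.stage_map_comp _ _).trans ?_)).trans
          (Category.id_comp _)
        exact σ.stage_map_self _
    · have h : σ.stage.map (homOfLE (min_le_right n n)) ≫ b = c.ι.app n := hb n
      rw [← h, ← Category.assoc, stage_map_comp, stage_map_self, Category.id_comp]
  base_toBody := by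
    rw [Iso.trans_hom, Category.assoc]
    exact congrArg (σ.base.hom ≫ ·) (σ.stage_map_comp _ _)

lemma head_comp (n : ℕ) :
    (σ.base.hom ≫ σ.stage.map (homOfLE n.zero_le)) ≫ σ.toBody n = f := by
  rw [Category.assoc, σ.toBody_naturality, σ.base_toBody]

/-- The cells of a complex are those below a given stage and those from that stage on. -/
noncomputable def headTailEquiv (n d : ℕ) :
    (σ.head n).Cell d ⊕ (σ.tail n).Cell d ≃ σ.Cell d :=
  Equiv.ofBijective (Sum.elim (fun s => ⟨s.1, s.2.1⟩) (fun s => ⟨n + s.1, s.2⟩)) <| by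
    constructor
    · rintro (⟨m, s, h⟩ | ⟨m, s⟩) (⟨m', s', h'⟩ | ⟨m', s'⟩) e
      · cases e
        rfl
      · have : m = n + m' := congrArg Sigma.fst e
        omega
      · have : n + m = m' := congrArg Sigma.fst e
        omega
      · have : n + m = n + m' := congrArg Sigma.fst e
        obtain rfl : m = m' := by omega
        have : s = s' := eq_of_heq (Sigma.mk.inj e).2
        rw [this]
    · rintro ⟨m, s⟩
      rcases lt_or_ge m n with h | h
      · exact ⟨Sum.inl ⟨m, s, h⟩, rfl⟩
      · obtain ⟨m, rfl⟩ := Nat.exists_eq_add_of_le h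
        exact ⟨Sum.inr ⟨m, s⟩, rfl⟩

lemma head_charMap (n : ℕ) {d : ℕ} (s : (σ.head n).Cell d) :
    (σ.head n).charMap s ≫ σ.toBody n = σ.charMap (σ.headTailEquiv n d (Sum.inl s)) := by
  have e : σ.stage.map (homOfLE (min_eq_left (Nat.succ_le_of_lt s.2.2)).ge) ≫
      σ.stage.map (homOfLE (min_le_right (s.1 + 1) n)) ≫ σ.toBody n = σ.toBody (s.1 + 1) := by
    rw [σ.toBody_naturality, σ.toBody_naturality]
  exact (Category.assoc _ _ _).trans ((Category.assoc _ _ _).trans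
    (congrArg ((σ.stratum s.1).char s.2.1 ≫ ·) e))

/-- The inclusion of a cell of the stratum `n` as a cell of the complex of strata from `n` on. -/
noncomputable def cellToTail {n d : ℕ} (s : (σ.stratum n).cells d) :
    CellCx.unit.obj ⟨d⟩ ⟶ (⟨_, _, _, σ.tail n⟩ : CellCx.{u}) :=
  CellCx.Hom.mk (A := ⟨_, _, _, SingleCell.str d⟩) (B := ⟨_, _, _, σ.tail n⟩)
    ((σ.stratum n).attach s) (σ.charMap ⟨n, s⟩)
    (fun
      | 0 => (σ.stratum n).attach s
      | m + 1 => (σ.stratum n).char s ≫ σ.stage.map (homOfLE (by omega : n + 1 ≤ n + (m + 1))))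
    (fun | _, _, .mk => s)
    (by
      rintro _ _ ⟨⟩
      exact Category.id_comp _)
    (by
      rintro _ _ ⟨⟩
      exact (Category.id_comp _).trans
        ((congrArg (_ ≫ ·) (σ.stage_map_self _)).trans (Category.comp_id _)))
    (by
      rintro (_ | m)
      · refine (congrArg (· ≫ _) (SingleCell.stage_succ d 0)).trans ?_
        refine (Category.assoc _ _ _).symm.trans ?_
        refine (congrArg (· ≫ _) ((σ.stratum n).attach_comp s).symm).trans ?_
        exact (Category.assoc _ _ _).trans (congrArg (_ ≫ ·) (σ.stage_map_comp _ _))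
      · refine (congrArg (· ≫ _) (SingleCell.stage_succ d (m + 1))).trans ?_
        refine (Category.id_comp _).trans ?_
        exact (congrArg (_ ≫ ·) (σ.stage_map_comp _ _).symm).trans (Category.assoc _ _ _).symm)
    ((Category.id_comp _).trans (Category.comp_id _).symm)
    (by
      rintro (_ | m)
      · exact σ.boundary_charMap s
      · refine (Category.id_comp _).trans ?_
        exact (congrArg (_ ≫ ·) (σ.toBody_naturality _).symm).trans (Category.assoc _ _ _).symm)

end CellStr

/-! ### Uniqueness of the functor to left maps -/

namespace AWFS

variable {C : Type w} [Category.{v} C] {W : AWFS C}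

/-- The heterogeneous equality is what the strict equation `F ⋙ W.forget = U` gives on morphisms. -/
lemma LeftStr.naturality {X Y X' Y' : C} {f : X ⟶ Y} {g : X' ⟶ Y'} {α : W.LeftStr f}
    {β : W.LeftStr g} {a b : W.LMap} (ha : α.toLMap = a) (hb : β.toLMap = b) (φ : a ⟶ b)
    (q : Arrow.mk f ⟶ Arrow.mk g) (hq : HEq φ.f q) :
    α.str ≫ W.M.map q = q.right ≫ β.str := by
  subst ha hb
  obtain rfl : φ.f = q := eq_of_heq hq
  exact congrArg CommaMorphism.right φ.h

lemma LMap.hom_heq {a a' b b' : W.LMap} (ha : a = a') (hb : b = b') {φ : a ⟶ b} {ψ : a' ⟶ b'}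
    (h : HEq φ.f ψ.f) : HEq φ ψ := by
  subst ha hb
  exact heq_of_eq (Comonad.Coalgebra.Hom.ext (eq_of_heq h))

end AWFS

namespace CellCx

open TopCat

variable {W : AWFS TopCat.{u}} {κ : ∀ d, W.LeftStr (diskBoundaryInclusion.{u} d)}
  {F : CellCx.{u} ⥤ W.LMap}

/-- The equation `hk` is kept separate because a complex's map equals the composite of head and tail
only propositionally. -/
lemma PreservesComposition.exists_push (hF : PreservesComposition F) {X Y Z : TopCat.{u}}
    {f : X ⟶ Y} {g : Y ⟶ Z} {k : X ⟶ Z} (hk : f ≫ g = k)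
    {σ : CellStr f} {τ : CellStr g} {ρ : CellStr k} (e : ∀ d, σ.Cell d ⊕ τ.Cell d ≃ ρ.Cell d)
    (hσ : ∀ d (s : σ.Cell d), σ.charMap s ≫ g = ρ.charMap (e d (Sum.inl s)))
    (hτ : ∀ d (s : τ.Cell d), τ.charMap s = ρ.charMap (e d (Sum.inr s)))
    {α : W.LeftStr f} {β : W.LeftStr g} {γ : W.LeftStr k}
    (hα : α.toLMap = F.obj ⟨_, _, _, σ⟩) (hβ : β.toLMap = F.obj ⟨_, _, _, τ⟩)
    (hγ : γ.toLMap = F.obj ⟨_, _, _, ρ⟩) :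
    ∃ q : Arrow.mk g ⟶ W.R.obj (Arrow.mk k), γ.str = β.str ≫ W.M.map q ≫ W.mul (Arrow.mk k) := by
  subst hk
  have h := hF σ τ ρ ⟨e, fun d s => (hσ d s).symm, fun d s => (hτ d s).symm⟩
  rw [← hα, ← hβ, ← hγ] at h
  rw [h.eq_comp]
  exact ⟨α.push g, rfl⟩

/-- Cutting at the stratum of a cell puts it at the bottom of the tail, where naturality against the
single-cell complex applies. -/
lemma PreservesComposition.isCellular (hF : PreservesComposition F) (hU : F ⋙ W.forget = U)
    (hκ : ∀ d, (κ d).toLMap = F.obj (unit.obj ⟨d⟩)) (A : CellCx.{u}) {γ : W.LeftStr A.map}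
    (hγ : γ.toLMap = F.obj A) : A.str.IsCellular κ γ.str := by
  rintro d ⟨n, s⟩
  obtain ⟨α, hα⟩ := AWFS.LMap.exists_leftStr (F.obj ⟨_, _, _, A.str.head n⟩)
    (Functor.congr_obj hU ⟨_, _, _, A.str.head n⟩)
  obtain ⟨β, hβ⟩ := AWFS.LMap.exists_leftStr (F.obj ⟨_, _, _, A.str.tail n⟩)
    (Functor.congr_obj hU ⟨_, _, _, A.str.tail n⟩)
  obtain ⟨q, hq⟩ := hF.exists_push (A.str.head_comp n) (A.str.headTailEquiv n)
    (fun d s => A.str.head_charMap n s) (fun _ _ => rfl) hα hβ hγ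
  have h : (κ d).str ≫ W.M.map (U.map (A.str.cellToTail s)) = A.str.charMap ⟨n, s⟩ ≫ β.str :=
    AWFS.LeftStr.naturality (hκ d) hβ (F.map (A.str.cellToTail s)) (U.map (A.str.cellToTail s))
      (Functor.hcongr_hom hU (A.str.cellToTail s))
  have hs : (κ d).IsAlg (A.str.charMap ⟨n, s⟩ ≫ β.str) := by
    rw [← h]
    exact AWFS.LeftStr.isAlg_str.map _
  rw [hq, ← Category.assoc, ← Category.assoc]
  exact (hs.map q).mul

lemma PreservesComposition.eq_toLMap (hF : PreservesComposition F) (hU : F ⋙ W.forget = U)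
    (hκ : ∀ d, (κ d).toLMap = F.obj (unit.obj ⟨d⟩)) : F = toLMap κ := by
  have hobj (A : CellCx.{u}) : F.obj A = (toLMap κ).obj A := by
    obtain ⟨γ, hγ⟩ := AWFS.LMap.exists_leftStr (F.obj A) (Functor.congr_obj hU A)
    rw [← hγ, ← CellStr.leftStr_eq (hF.isCellular hU hκ A hγ)]
    rfl
  exact Functor.hext hobj fun A B φ =>
    AWFS.LMap.hom_heq (hobj A) (hobj B) (Functor.hcongr_hom hU φ)

theorem existsUnique_functor (W : AWFS TopCat.{u}) (F : Discrete ℕ ⥤ W.LMap)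
    (hF : F ⋙ W.forget = genCells) :
    ∃! F' : CellCx.{u} ⥤ W.LMap,
      F' ⋙ W.forget = U ∧ F = unit ⋙ F' ∧ PreservesComposition F' := by
  have h (d : ℕ) : ∃ κ : W.LeftStr (diskBoundaryInclusion.{u} d), κ.toLMap = F.obj ⟨d⟩ :=
    AWFS.LMap.exists_leftStr (F.obj ⟨d⟩) (Functor.congr_obj hF ⟨d⟩)
  choose κ hκ using h
  refine ⟨toLMap κ, ⟨rfl, Discrete.functor_ext fun d => ?_, toLMap_preservesComposition κ⟩, ?_⟩
  · rw [← hκ, ← leftStr_singleCell κ d]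
    rfl
  · rintro F' ⟨hU, rfl, hF'⟩
    exact PreservesComposition.eq_toLMap hF' hU hκ

end CellCx

/-! ### Cell systems -/

namespace TopCat

instance (d : ℕ) : T2Space (disk.{u} d) :=
  inferInstanceAs (T2Space (ULift (Metric.closedBall (0 : EuclideanSpace ℝ (Fin d)) 1)))

lemma isClosedMap_diskBoundaryInclusion (d : ℕ) : IsClosedMap (diskBoundaryInclusion.{u} d) :=
  (diskBoundaryInclusion.{u} d).hom.continuous.isClosedMap

lemma diskBoundaryInclusion_injective (d : ℕ) :
    Function.Injective (diskBoundaryInclusion.{u} d) :=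
  (mono_iff_injective _).mp inferInstance

end TopCat

open TopCat

/-- A space `Z` presented as the union of the image of `f : X ⟶ Z` and of a family of cells, each
attached to the image of `X` and to the cells that precede it in a well-founded order. -/
structure CellSystem {X Z : TopCat.{u}} (f : X ⟶ Z) where
  cells : ℕ → Type u
  char {d : ℕ} (c : cells d) : 𝔻 d ⟶ Z
  /-- Each point of `Z` comes from a unique point of `X` or of the interior of a cell. -/
  locate : Z → X ⊕ Σ c : Σ d, cells d, 𝔻 c.1
  base_of_locate {z : Z} {x : X} : locate z = Sum.inl x → f x = z
  char_of_locate {z : Z} {c : Σ d, cells d} {p : 𝔻 c.1} :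
    locate z = Sum.inr ⟨c, p⟩ → char c.2 p = z
  locate_base (x : X) : locate (f x) = Sum.inl x
  locate_char (c : Σ d, cells d) (p : 𝔻 c.1) :
    p ∉ Set.range (diskBoundaryInclusion c.1) → locate (char c.2 p) = Sum.inr ⟨c, p⟩
  lower : (Σ d, cells d) → (Σ d, cells d) → Prop
  wf : WellFounded lower
  lower_of_boundary {c c' : Σ d, cells d} {b : ∂𝔻 c.1} {p : 𝔻 c'.1} :
    locate (char c.2 (diskBoundaryInclusion c.1 b)) = Sum.inr ⟨c', p⟩ → lower c' c
  isClosed_of (A : Set Z) : IsClosed (f ⁻¹' A) →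
    (∀ c : Σ d, cells d, IsClosed (char c.2 ⁻¹' A)) → IsClosed A
  isClosed_boundary (A : Set Z) (c : Σ d, cells d) : IsClosed (f ⁻¹' A) →
    (∀ c', lower c' c → IsClosed (char c'.2 ⁻¹' A)) →
    IsClosed ((diskBoundaryInclusion c.1 ≫ char c.2) ⁻¹' A)

namespace CellSystem

variable {X Z : TopCat.{u}} {f : X ⟶ Z} (S : CellSystem f)

/-- The set of all cells. -/
abbrev Idx : Type u := Σ d, S.cells d

/-- The sphere is compact and the disk Hausdorff, so the boundary part is closed in the disk, and
adding finitely many interior points keeps it closed. -/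
lemma isClosed_char {A : Set Z} {c : S.Idx}
    (h : IsClosed ((diskBoundaryInclusion c.1 ≫ S.char c.2) ⁻¹' A))
    (h' : (S.char c.2 ⁻¹' A \ Set.range (diskBoundaryInclusion c.1)).Finite) :
    IsClosed (S.char c.2 ⁻¹' A) := by
  have : S.char c.2 ⁻¹' A = diskBoundaryInclusion c.1 ''
      ((diskBoundaryInclusion c.1 ≫ S.char c.2) ⁻¹' A) ∪
      (S.char c.2 ⁻¹' A \ Set.range (diskBoundaryInclusion c.1)) := by
    ext p
    constructor
    · intro hp
      by_cases hb : p ∈ Set.range (diskBoundaryInclusion c.1)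
      · obtain ⟨b, rfl⟩ := hb
        exact Or.inl ⟨b, hp, rfl⟩
      · exact Or.inr ⟨hp, hb⟩
    · rintro (⟨b, hb, rfl⟩ | hp)
      · exact hb
      · exact hp.1
  rw [this]
  exact (isClosedMap_diskBoundaryInclusion _ _ h).union h'.isClosed

/-- No separation is assumed of `X`, but `z` misses its image, and each open cell contains `z` at
most once. -/
lemma isClosed_singleton {z : Z} {c : S.Idx} {p : 𝔻 c.1} (hz : S.locate z = Sum.inr ⟨c, p⟩) :
    IsClosed ({z} : Set Z) := by
  have hf : IsClosed (f ⁻¹' {z}) := by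
    have : f ⁻¹' {z} = ∅ := by
      ext x
      simp only [Set.mem_preimage, Set.mem_singleton_iff, Set.mem_empty_iff_false, iff_false]
      rintro rfl
      simp [S.locate_base] at hz
    rw [this]
    exact isClosed_empty
  refine S.isClosed_of _ hf fun c' => ?_
  induction c' using S.wf.induction with
  | _ c' ih =>
    refine S.isClosed_char (S.isClosed_boundary _ _ hf ih) (Set.Subsingleton.finite ?_)
    rintro p₁ ⟨h₁, h₁'⟩ p₂ ⟨h₂, h₂'⟩
    have e : S.char c'.2 p₁ = S.char c'.2 p₂ := h₁.trans h₂.symm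
    have e' := (S.locate_char c' p₁ h₁').symm.trans
      ((congrArg S.locate e).trans (S.locate_char c' p₂ h₂'))
    simpa using e'

/-- The cells whose interiors meet the boundary of a given cell. -/
def boundaryCells (c : S.Idx) : Set S.Idx :=
  { c' | ∃ b p, S.locate (S.char c.2 (diskBoundaryInclusion c.1 b)) = Sum.inr ⟨c', p⟩ }

lemma mem_of_locate_char {c c' : S.Idx} {p : 𝔻 c.1} {p' : 𝔻 c'.1}
    (h : S.locate (S.char c.2 p) = Sum.inr ⟨c', p'⟩) : c' ∈ insert c (S.boundaryCells c) := by
  by_cases hp : p ∈ Set.range (diskBoundaryInclusion c.1)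
  · obtain ⟨b, rfl⟩ := hp
    exact Or.inr ⟨b, p', h⟩
  · rw [S.locate_char c p hp] at h
    cases h
    exact Or.inl rfl

/-- Pick a boundary point in each open cell met. By well-founded induction any set of the picked
points has closed preimage in the sphere, so compactness leaves only finitely many. -/
lemma finite_boundaryCells (c : S.Idx) : (S.boundaryCells c).Finite := by
  induction c using S.wf.induction with
  | _ c ih =>
    choose b p hbp using fun c' : S.boundaryCells c => c'.2
    let z (c' : S.boundaryCells c) : Z := S.char c.2 (diskBoundaryInclusion c.1 (b c'))
    have hz {c₁ c₂ : S.boundaryCells c} (h : z c₁ = z c₂) : c₁ = c₂ := by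
      have e := (hbp c₁).symm.trans ((congrArg S.locate h).trans (hbp c₂))
      exact Subtype.ext (congrArg Sigma.fst (Sum.inr.inj e))
    have closed (Q : Set (S.boundaryCells c)) :
        IsClosed ((diskBoundaryInclusion c.1 ≫ S.char c.2) ⁻¹' (z '' Q)) := by
      refine S.isClosed_boundary _ _ ?_ fun c' hc' => ?_
      · have : f ⁻¹' (z '' Q) = ∅ := by
          ext x
          simp only [Set.mem_preimage, Set.mem_empty_iff_false, iff_false]
          rintro ⟨c', -, h⟩
          have := (hbp c').symm.trans ((congrArg S.locate h).trans (S.locate_base x))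
          simp at this
        rw [this]
        exact isClosed_empty
      -- A lower cell meets only its own interior, finitely many other open cells and `X`, hence
      -- finitely many picked points, each closed.
      · have e : S.char c'.2 ⁻¹' (z '' Q) = S.char c'.2 ⁻¹'
            (z '' (Q ∩ Subtype.val ⁻¹' insert c' (S.boundaryCells c'))) := by
          refine Set.Subset.antisymm ?_ (Set.preimage_mono (Set.image_mono Set.inter_subset_left))
          rintro q ⟨c'', h, hq⟩
          refine ⟨c'', ⟨h, ?_⟩, hq⟩
          exact S.mem_of_locate_char ((congrArg S.locate hq.symm).trans (hbp c''))
        rw [e]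
        have fin : (Q ∩ Subtype.val ⁻¹' insert c' (S.boundaryCells c')).Finite :=
          (((ih c' hc').insert c').preimage Subtype.val_injective.injOn).subset
            Set.inter_subset_right
        refine IsClosed.preimage (S.char c'.2).hom.continuous ?_
        rw [← Set.biUnion_of_singleton (z '' _)]
        refine (fin.image z).isClosed_biUnion ?_
        rintro _ ⟨c'', -, rfl⟩
        exact S.isClosed_singleton (hbp c'')
    rcases (S.boundaryCells c).eq_empty_or_nonempty with h | ⟨c₀, h₀⟩
    · rw [h]
      exact Set.finite_empty
    -- The open set of index `c'` excludes every picked point except that of `c'`, so a finite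
    -- subcover must use every index.
    obtain ⟨t, ht⟩ := isCompact_univ.elim_finite_subcover
      (fun c' => ((diskBoundaryInclusion c.1 ≫ S.char c.2) ⁻¹' (z '' {c'}ᶜ))ᶜ)
      (fun c' => (closed _).isOpen_compl) (fun x _ => by
        rw [Set.mem_iUnion]
        by_cases hx : ∃ c', z c' = S.char c.2 (diskBoundaryInclusion c.1 x)
        · obtain ⟨c', hc'⟩ := hx
          refine ⟨c', ?_⟩
          rintro ⟨c'', hne, h⟩
          exact hne (hz (h.trans hc'.symm))
        · refine ⟨⟨c₀, h₀⟩, ?_⟩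
          rintro ⟨c'', -, h⟩
          exact hx ⟨c'', h⟩)
    have : Finite (S.boundaryCells c) := by
      refine Finite.of_surjective (fun c' : t => c'.1) fun c' => ?_
      obtain ⟨c'', hc'', h⟩ := Set.mem_iUnion₂.mp (ht (Set.mem_univ (b c')))
      refine ⟨⟨c'', hc''⟩, ?_⟩
      by_contra hne
      exact h ⟨c', fun e => hne e.symm, rfl⟩
    exact Set.toFinite _

lemma wf_boundaryCells : WellFounded fun c' c => c' ∈ S.boundaryCells c :=
  Subrelation.wf (fun ⟨_, _, h⟩ => S.lower_of_boundary h) S.wf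

/-- The lowest stage to which a cell can be attached. -/
noncomputable def height : S.Idx → ℕ :=
  S.wf_boundaryCells.fix fun c ih => ⨆ c' : S.boundaryCells c, ih c'.1 c'.2 + 1

/-- Finiteness bounds the supremum in `ℕ`, which otherwise would take the default value 0. -/
lemma height_le_iff {c : S.Idx} {n : ℕ} :
    S.height c ≤ n ↔ ∀ c' ∈ S.boundaryCells c, S.height c' < n := by
  have := (S.finite_boundaryCells c).to_subtype
  rw [height, WellFounded.fix_eq, ciSup_le_iff' (Set.finite_range _).bddAbove]
  exact Subtype.forall

/-- The subspace formed by `X` and the cells of height less than `n`. -/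
def skeleton (n : ℕ) : Set Z := { z | ∀ c p, S.locate z = Sum.inr ⟨c, p⟩ → S.height c < n }

lemma skeleton_mono {m n : ℕ} (h : m ≤ n) : S.skeleton m ⊆ S.skeleton n :=
  fun _ hz c p e => (hz c p e).trans_le h

lemma base_mem_skeleton (n : ℕ) (x : X) : f x ∈ S.skeleton n := fun c p e => by
  simp [S.locate_base] at e

lemma boundary_mem_skeleton {n : ℕ} {c : S.Idx} (h : S.height c ≤ n) (b : ∂𝔻 c.1) :
    S.char c.2 (diskBoundaryInclusion c.1 b) ∈ S.skeleton n :=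
  fun c' p e => S.height_le_iff.mp h c' ⟨b, p, e⟩

lemma char_mem_skeleton {n : ℕ} {c : S.Idx} (h : S.height c < n) (p : 𝔻 c.1) :
    S.char c.2 p ∈ S.skeleton n := fun c' p' e => by
  rcases S.mem_of_locate_char e with rfl | hc'
  · exact h
  · exact (S.height_le_iff.mp le_rfl c' hc').trans h

lemma interior_notMem_skeleton {n : ℕ} {c : S.Idx} (h : n ≤ S.height c) {p : 𝔻 c.1}
    (hp : p ∉ Set.range (diskBoundaryInclusion c.1)) : S.char c.2 p ∉ S.skeleton n :=
  fun hz => (hz c p (S.locate_char c p hp)).not_ge h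

lemma exists_mem_skeleton (z : Z) : ∃ n, z ∈ S.skeleton n := by
  rcases h : S.locate z with x | ⟨c, p⟩
  · exact ⟨0, fun c p e => by simp [h] at e⟩
  · refine ⟨S.height c + 1, ?_⟩
    rw [← S.char_of_locate h]
    exact S.char_mem_skeleton (Nat.lt_succ_self _) p

/-- The interiors of cells of height at least `n` miss `A`, so on them closedness only concerns the
boundary and follows by well-founded induction. -/
lemma isClosed_of_subset_skeleton {n : ℕ} {A : Set Z} (hA : A ⊆ S.skeleton n)
    (hf : IsClosed (f ⁻¹' A))
    (hc : ∀ c : S.Idx, S.height c < n → IsClosed (S.char c.2 ⁻¹' A)) : IsClosed A := by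
  refine S.isClosed_of A hf fun c => ?_
  induction c using S.wf.induction with
  | _ c ih =>
    by_cases h : S.height c < n
    · exact hc c h
    · refine S.isClosed_char (S.isClosed_boundary _ _ hf ih) ?_
      convert Set.finite_empty
      ext p
      simp only [Set.mem_sdiff, Set.mem_preimage, Set.mem_empty_iff_false, iff_false, not_and,
        not_not]
      intro hp
      by_contra hp'
      exact S.interior_notMem_skeleton (not_lt.mp h) hp' (hA hp)

end CellSystem

/-! ### The relative cell complex of a cell system -/

namespace CellSystem

variable {X Z : TopCat.{u}} {f : X ⟶ Z} (S : CellSystem f)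

/-- The skeleta as a sequence of spaces. -/
def stage : ℕ ⥤ TopCat.{u} where
  obj n := TopCat.of (S.skeleton n)
  map h := TopCat.ofHom ⟨Set.inclusion (S.skeleton_mono (leOfHom h)), continuous_inclusion _⟩

/-- The inclusion of a skeleton. -/
def toBody (n : ℕ) : S.stage.obj n ⟶ Z := TopCat.ofHom ⟨Subtype.val, continuous_subtype_val⟩

/-- A map into `Z`, as a map into a skeleton that contains its image. -/
def codRestrict {T : TopCat.{u}} {n : ℕ} (a : T ⟶ Z) (h : ∀ t, a t ∈ S.skeleton n) :
    T ⟶ S.stage.obj n :=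
  TopCat.ofHom ⟨fun t => ⟨a t, h t⟩, a.hom.continuous.subtype_mk h⟩

variable {S} in
lemma stage_ext {n : ℕ} {x y : S.stage.obj n} (h : S.toBody n x = S.toBody n y) : x = y :=
  Subtype.ext h

lemma toBody_mem {n : ℕ} (x : S.stage.obj n) : S.toBody n x ∈ S.skeleton n := x.2

/-- The subspace topology on a skeleton is the weak topology of `X` and the cells it contains. -/
lemma continuous_of_stage {n : ℕ} {T : Type*} [TopologicalSpace T] {t : S.stage.obj n → T}
    (hf : Continuous fun x => t (S.codRestrict f (S.base_mem_skeleton n) x))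
    (hc : ∀ (c : S.Idx) (h : S.height c < n),
      Continuous fun p => t (S.codRestrict (S.char c.2) (S.char_mem_skeleton h) p)) :
    Continuous t := by
  refine continuous_iff_isClosed.mpr fun A hA => ?_
  have e : t ⁻¹' A = Subtype.val ⁻¹' (Subtype.val '' (t ⁻¹' A) : Set Z) :=
    (Set.preimage_image_eq _ Subtype.val_injective).symm
  rw [e]
  refine IsClosed.preimage continuous_subtype_val
    (S.isClosed_of_subset_skeleton (n := n) ?_ ?_ fun c h => ?_)
  · rintro _ ⟨x, -, rfl⟩
    exact x.2
  · convert hA.preimage hf using 1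
    ext x
    exact ⟨fun ⟨y, hy, e⟩ => by
        obtain rfl : y = ⟨f x, S.base_mem_skeleton n x⟩ := Subtype.ext e
        exact hy,
      fun hx => ⟨_, hx, rfl⟩⟩
  · convert hA.preimage (hc c h) using 1
    ext p
    exact ⟨fun ⟨y, hy, e⟩ => by
        obtain rfl : y = ⟨S.char c.2 p, S.char_mem_skeleton h p⟩ := Subtype.ext e
        exact hy,
      fun hx => ⟨_, hx, rfl⟩⟩

lemma stage_cases {n : ℕ} (x : S.stage.obj (n + 1)) :
    (∃ y : S.stage.obj n, S.stage.map (homOfLE n.le_succ) y = x) ∨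
    ∃ (c : S.Idx) (h : S.height c = n) (p : 𝔻 c.1), p ∉ Set.range (diskBoundaryInclusion c.1) ∧
      S.codRestrict (S.char c.2) (S.char_mem_skeleton (h.trans_lt n.lt_succ_self)) p = x := by
  by_cases hx : S.toBody _ x ∈ S.skeleton n
  · exact Or.inl ⟨⟨_, hx⟩, rfl⟩
  · simp only [skeleton, Set.mem_ofPred_eq, not_forall, not_lt] at hx
    obtain ⟨c, p, h, hc⟩ := hx
    have hc' : S.height c < n + 1 := x.2 c p h
    refine Or.inr ⟨c, by omega, p, ?_, stage_ext (S.char_of_locate h)⟩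
    rintro ⟨b, rfl⟩
    have := S.lower_of_boundary ((congrArg S.locate (S.char_of_locate h)).trans h)
    exact S.wf.irrefl.irrefl _ this

/-- The cells of height `n` form a stratum on the `n`-th skeleton. -/
noncomputable def stratum (n : ℕ) : Stratum (S.stage.map (homOfLE n.le_succ)) where
  cells d := { c : S.cells d // S.height ⟨d, c⟩ = n }
  attach {d} c := S.codRestrict (diskBoundaryInclusion d ≫ S.char c.1)
    (S.boundary_mem_skeleton (c := ⟨d, c.1⟩) c.2.le)
  char {d} c := S.codRestrict (S.char c.1)
    (S.char_mem_skeleton (c := ⟨d, c.1⟩) (c.2.trans_lt n.lt_succ_self))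
  isPushout := by
    refine Stratum.isPushout_of
      (attach := fun {d} (c : { c : S.cells d // S.height ⟨d, c⟩ = n }) =>
        S.codRestrict (diskBoundaryInclusion d ≫ S.char c.1)
          (S.boundary_mem_skeleton (c := ⟨d, c.1⟩) c.2.le))
      (char := fun {d} (c : { c : S.cells d // S.height ⟨d, c⟩ = n }) =>
        S.codRestrict (S.char c.1)
          (S.char_mem_skeleton (c := ⟨d, c.1⟩) (c.2.trans_lt n.lt_succ_self)))
      (fun d s => rfl) (fun {T a b} h h' => ?_) (fun {T} a x hx => ?_)
    · ext z
      rcases S.stage_cases z with ⟨y, rfl⟩ | ⟨c, hc, p, -, rfl⟩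
      · exact ConcreteCategory.congr_hom h y
      · exact ConcreteCategory.congr_hom (h' c.1 ⟨c.2, hc⟩) p
    -- The value at `z` is required to fit all presentations of `z` at once, by the previous stage
    -- and by new cells; continuity can then use any of them.
    · have key (z : S.stage.obj (n + 1)) : ∃ t : T,
          (∀ y, S.stage.map (homOfLE n.le_succ) y = z → a y = t) ∧
          ∀ d (c : { c : S.cells d // S.height ⟨d, c⟩ = n }) p,
            S.char c.1 p = S.toBody _ z → x d c p = t := by
        have bdy (d : ℕ) (c : { c : S.cells d // S.height ⟨d, c⟩ = n }) (b : ∂𝔻 d)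
            (y : S.stage.obj n)
            (h : S.char c.1 (diskBoundaryInclusion d b) = S.toBody _ y) :
            x d c (diskBoundaryInclusion d b) = a y :=
          (ConcreteCategory.congr_hom (hx d c) b).symm.trans (congrArg a (stage_ext h))
        rcases S.stage_cases z with ⟨y, rfl⟩ | ⟨c, hc, p, hp, rfl⟩
        · refine ⟨a y, fun y' h => ?_, fun d c p h => ?_⟩
          · have h' : S.toBody n y' = S.toBody n y := congrArg (S.toBody (n + 1)) h
            rw [stage_ext h']
          · by_cases hp : p ∈ Set.range (diskBoundaryInclusion d)
            · obtain ⟨b, rfl⟩ := hp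
              exact bdy d c b y h
            · refine absurd ?_ (S.interior_notMem_skeleton (c := ⟨d, c.1⟩) c.2.ge hp)
              exact (congrArg (· ∈ S.skeleton n) h).mpr y.2
        · have hl : S.locate (S.char c.2 p) = Sum.inr ⟨c, p⟩ := S.locate_char c p hp
          refine ⟨x c.1 ⟨c.2, hc⟩ p, fun y h => ?_, fun d c' p' h => ?_⟩
          · refine absurd ?_ (S.interior_notMem_skeleton hc.ge hp)
            exact (congrArg (· ∈ S.skeleton n) (congrArg (S.toBody _) h)).mp y.2
          · by_cases hp' : p' ∈ Set.range (diskBoundaryInclusion d)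
            · obtain ⟨b, rfl⟩ := hp'
              refine absurd ?_ (S.interior_notMem_skeleton hc.ge hp)
              exact (congrArg (· ∈ S.skeleton n) h).mp
                (S.boundary_mem_skeleton (c := ⟨d, c'.1⟩) c'.2.le b)
            · have e := (S.locate_char ⟨d, c'.1⟩ p' hp').symm.trans
                ((congrArg S.locate h).trans hl)
              obtain ⟨c', hc'⟩ := c'
              cases e
              rfl
      choose t ht ht' using key
      have cont : Continuous t := by
        refine S.continuous_of_stage ?_ fun c hc => ?_
        · refine Continuous.congr (f := fun y => a (S.codRestrict f (S.base_mem_skeleton n) y))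
            ?_ fun y => ?_
          · exact (S.codRestrict f (S.base_mem_skeleton n) ≫ a).hom.continuous
          · exact ht _ _ rfl
        · rcases Nat.lt_succ_iff_lt_or_eq.mp hc with hc' | hc'
          · refine Continuous.congr
              (f := fun p => a (S.codRestrict (S.char c.2) (S.char_mem_skeleton hc') p))
              ?_ fun y => ?_
            · exact (S.codRestrict (S.char c.2) (S.char_mem_skeleton hc') ≫ a).hom.continuous
            · exact ht _ _ rfl
          · exact (x c.1 ⟨c.2, hc'⟩).hom.continuous.congr fun p => ht' _ _ ⟨c.2, hc'⟩ p rfl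
      refine ⟨TopCat.ofHom ⟨t, cont⟩, ?_, fun d c => ?_⟩
      · ext y
        exact (ht _ y rfl).symm
      · ext p
        exact (ht' _ d c p rfl).symm

/-- The space `X` is the lowest skeleton. -/
noncomputable def baseIso : X ≅ S.stage.obj 0 :=
  have h (z : S.stage.obj 0) : ∃ x, S.locate z.1 = Sum.inl x := by
    rcases e : S.locate z.1 with x | ⟨c, p⟩
    · exact ⟨x, rfl⟩
    · exact absurd (z.2 c p e) (Nat.not_lt_zero _)
  have inv (x : X) : (h (S.codRestrict f (S.base_mem_skeleton 0) x)).choose = x :=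
    Sum.inl.inj ((h _).choose_spec.symm.trans (S.locate_base x))
  { hom := S.codRestrict f (S.base_mem_skeleton 0)
    inv := TopCat.ofHom ⟨fun z => (h z).choose, S.continuous_of_stage
      (continuous_id.congr fun x => (inv x).symm) fun _ hc => absurd hc (Nat.not_lt_zero _)⟩
    hom_inv_id := by
      ext x
      exact inv x
    inv_hom_id := by
      ext z
      exact stage_ext (S.base_of_locate (h z).choose_spec) }

lemma existsUnique_bodyDesc {T : TopCat.{u}} (a : ∀ n, S.stage.obj n ⟶ T)
    (ha : ∀ {m n : ℕ} (h : m ≤ n), S.stage.map (homOfLE h) ≫ a n = a m) :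
    ∃! b : Z ⟶ T, ∀ n, S.toBody n ≫ b = a n := by
  choose n hn using S.exists_mem_skeleton
  let t (z : Z) : T := a (n z) ⟨z, hn z⟩
  have ht (m : ℕ) (z : S.stage.obj m) : t (S.toBody m z) = a m z := by
    rcases le_total m (n (S.toBody m z)) with h | h
    · exact ConcreteCategory.congr_hom (ha h) z
    · exact (ConcreteCategory.congr_hom (ha h) ⟨S.toBody m z, hn _⟩).symm
  have cont : Continuous t := by
    refine continuous_iff_isClosed.mpr fun A hA => S.isClosed_of _ ?_ fun c => ?_
    · refine hA.preimage (f := fun x => t (f x)) ?_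
      exact (S.codRestrict f (S.base_mem_skeleton 0) ≫ a 0).hom.continuous.congr
        fun x => (ht 0 _).symm
    · refine hA.preimage (f := fun p => t (S.char c.2 p)) ?_
      exact (S.codRestrict (S.char c.2) (S.char_mem_skeleton (Nat.lt_succ_self _)) ≫
        a _).hom.continuous.congr fun x => (ht _ _).symm
  refine ⟨TopCat.ofHom ⟨t, cont⟩, fun m => ?_, fun b hb => ?_⟩
  · ext z
    exact ht m z
  · ext z
    exact ConcreteCategory.congr_hom (hb (n z)) ⟨z, hn z⟩

/-- The relative cell complex of a cell system. -/
noncomputable def toCellStr : CellStr f where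
  stage := S.stage
  base := S.baseIso
  stratum := S.stratum
  proper n d s m h := by
    rintro ⟨b, hb⟩
    -- A factorisation through the `m`-th skeleton forces every open cell met by the boundary to
    -- have height below `m`, so the cell has height at most `m`.
    refine h.not_ge (s.2.ge.trans (S.height_le_iff.mpr ?_))
    rintro c' ⟨x, p, hx⟩
    have e : S.toBody m (b x) = S.char s.1 (diskBoundaryInclusion d x) :=
      congrArg (S.toBody n) (ConcreteCategory.congr_hom hb x)
    exact S.toBody_mem (b x) c' p ((congrArg S.locate e).trans hx)
  toBody := S.toBody
  toBody_naturality _ := rfl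
  isColimit := IsColimit.ofExistsUnique fun c =>
    S.existsUnique_bodyDesc c.ι.app fun h => c.w (homOfLE h)
  base_toBody := rfl

/-- The cells of the relative cell complex of a cell system. -/
noncomputable def cellEquiv (d : ℕ) : S.cells d ≃ S.toCellStr.Cell d :=
  (Equiv.sigmaFiberEquiv fun c : S.cells d => S.height ⟨d, c⟩).symm

end CellSystem

/-! ### The cell system of a relative cell complex -/

namespace TopCat

/-- A function, as a map into an indiscrete space. -/
def toIndiscrete {X : TopCat.{u}} {P : Type u} (a : X → P) : X ⟶ trivial.obj P :=
  @TopCat.ofHom _ _ _ ⊤ (@ContinuousMap.mk _ _ _ ⊤ a continuous_top)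

end TopCat

namespace Stratum

variable {X X' : TopCat.{u}} {i : X ⟶ X'} (S : Stratum i)

/-- Every function into an indiscrete space is continuous, so the pushout of spaces is also one of
sets. -/
lemma exists_fun {P : Type u} (a : X → P) (x : ∀ d, S.cells d → 𝔻 d → P)
    (h : ∀ d (s : S.cells d) b, a (S.attach s b) = x d s (diskBoundaryInclusion d b)) :
    ∃ t : X' → P, (∀ y, t (i y) = a y) ∧ ∀ d (s : S.cells d) p, t (S.char s p) = x d s p := by
  obtain ⟨t, h₁, h₂⟩ := S.exists_desc (toIndiscrete a) (fun d s => toIndiscrete (x d s))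
    (fun d s => by
      ext b
      exact h d s b)
  exact ⟨t, fun y => ConcreteCategory.congr_hom h₁ y,
    fun d s p => ConcreteCategory.congr_hom (h₂ d s) p⟩

lemma cases (x : X') : (∃ y, i y = x) ∨
    ∃ (d : ℕ) (s : S.cells d) (p : 𝔻 d), p ∉ Set.range (diskBoundaryInclusion d) ∧
      S.char s p = x := by
  let Q (x : X') : Prop := (∃ y, i y = x) ∨
    ∃ (d : ℕ) (s : S.cells d) (p : 𝔻 d), p ∉ Set.range (diskBoundaryInclusion d) ∧
      S.char s p = x
  have h : toIndiscrete (fun x => ULift.up (Q x)) = toIndiscrete (fun _ => ULift.up True) := by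
    refine S.hom_ext ?_ fun d s => ?_
    · ext y
      exact congrArg ULift.up (eq_true (Or.inl ⟨y, rfl⟩))
    · ext p
      refine congrArg ULift.up (eq_true ?_)
      by_cases hp : p ∈ Set.range (diskBoundaryInclusion d)
      · obtain ⟨b, rfl⟩ := hp
        exact Or.inl ⟨S.attach s b, ConcreteCategory.congr_hom (S.attach_comp s) b⟩
      · exact Or.inr ⟨d, s, p, hp, rfl⟩
  exact of_eq_true (congrArg ULift.down (ConcreteCategory.congr_hom h x))

/-- Closed sets correspond to maps into the Sierpiński space, which the pushout glues. -/
lemma isClosed_of {A : Set X'} (h : IsClosed (i ⁻¹' A))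
    (h' : ∀ d (s : S.cells d), IsClosed (S.char s ⁻¹' A)) : IsClosed A := by
  let q {T : TopCat.{u}} (B : Set T) (hB : IsClosed B) : T ⟶ TopCat.of (ULift.{u} Prop) :=
    TopCat.ofHom ⟨fun t => ULift.up (t ∈ Bᶜ),
      continuous_uliftUp.comp (isOpen_iff_continuous_mem.mp hB.isOpen_compl)⟩
  obtain ⟨t, h₁, h₂⟩ := S.exists_desc (q _ h) (fun d s => q _ (h' d s)) (fun d s => by
    ext b
    exact iff_of_eq (congrArg (· ∉ A) (ConcreteCategory.congr_hom (S.attach_comp s) b)))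
  have ht (x : X') : t x = ULift.up (x ∈ Aᶜ) := by
    rcases S.cases x with ⟨y, rfl⟩ | ⟨d, s, p, -, rfl⟩
    · exact ConcreteCategory.congr_hom h₁ y
    · exact ConcreteCategory.congr_hom (h₂ d s) p
  have : IsOpen Aᶜ := by
    refine isOpen_iff_continuous_mem.mpr ?_
    exact (continuous_uliftDown.comp t.hom.continuous).congr fun x => congrArg ULift.down (ht x)
  exact isOpen_compl_iff.mp this

end Stratum

/-! ### Points and closed sets of a relative cell complex -/

namespace CellStr

variable {X Y Z : TopCat.{u}} {f : X ⟶ Y} {g : Y ⟶ Z} (σ : CellStr f)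

lemma toBody_step_apply {n : ℕ} (x : σ.stage.obj n) :
    σ.toBody (n + 1) (σ.stage.map (homOfLE n.le_succ) x) = σ.toBody n x :=
  ConcreteCategory.congr_hom (σ.step_toBody n) x

lemma toBody_zero_apply (x : σ.stage.obj 0) : f (σ.base.inv x) = σ.toBody 0 x :=
  ConcreteCategory.congr_hom σ.base_inv_comp x

lemma boundary_charMap_apply {n d : ℕ} (s : (σ.stratum n).cells d) (b : ∂𝔻 d) :
    σ.charMap ⟨n, s⟩ (diskBoundaryInclusion d b) = σ.toBody n ((σ.stratum n).attach s b) :=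
  ConcreteCategory.congr_hom (σ.boundary_charMap s) b

lemma exists_toBody (y : Y) : ∃ n x, σ.toBody n x = y := by
  obtain ⟨n, x, hx⟩ := Concrete.isColimit_exists_rep _ σ.isColimit y
  exact ⟨n, x, hx⟩

lemma stage_cases {n : ℕ} (x : σ.stage.obj n) : (∃ y, f y = σ.toBody n x) ∨
    ∃ (d m : ℕ) (_ : m < n) (s : (σ.stratum m).cells d) (p : 𝔻 d),
      p ∉ Set.range (diskBoundaryInclusion d) ∧ σ.charMap ⟨m, s⟩ p = σ.toBody n x := by
  induction n with
  | zero => exact Or.inl ⟨_, σ.toBody_zero_apply x⟩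
  | succ n ih =>
    rcases (σ.stratum n).cases x with ⟨y, rfl⟩ | ⟨d, s, p, hp, rfl⟩
    · rw [toBody_step_apply]
      rcases ih y with h | ⟨d, m, hm, h⟩
      · exact Or.inl h
      · exact Or.inr ⟨d, m, hm.trans n.lt_succ_self, h⟩
    · exact Or.inr ⟨d, n, n.lt_succ_self, s, p, hp, rfl⟩

/-- Only strata below `n` enter: this yields the boundary condition of a cell system, as attaching
maps of stratum `n` land in stage `n`. -/
lemma isClosed_toBody_preimage {A : Set Y} (hf : IsClosed (f ⁻¹' A)) (n : ℕ)
    (h : ∀ m, m < n → ∀ d (s : (σ.stratum m).cells d), IsClosed (σ.charMap ⟨m, s⟩ ⁻¹' A)) :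
    IsClosed (σ.toBody n ⁻¹' A) := by
  induction n with
  | zero =>
    rw [← σ.base_inv_comp]
    exact hf.preimage σ.base.inv.hom.continuous
  | succ n ih =>
    refine (σ.stratum n).isClosed_of ?_ (h n n.lt_succ_self)
    convert ih fun m hm => h m (hm.trans n.lt_succ_self) using 1
    ext x
    exact iff_of_eq (congrArg (· ∈ A) (σ.toBody_step_apply x))

lemma isClosed_of {A : Set Y} (hf : IsClosed (f ⁻¹' A))
    (h : ∀ d (s : σ.Cell d), IsClosed (σ.charMap s ⁻¹' A)) : IsClosed A :=
  (TopCat.isClosed_iff_of_isColimit _ σ.isColimit A).mpr fun n =>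
    σ.isClosed_toBody_preimage hf n fun m _ d s => h d ⟨m, s⟩

lemma exists_locate : ∃ l : Y → X ⊕ Σ c : Σ d, σ.Cell d, 𝔻 c.1,
    (∀ x, l (f x) = Sum.inl x) ∧
    ∀ (c : Σ d, σ.Cell d) (p : 𝔻 c.1), p ∉ Set.range (diskBoundaryInclusion c.1) →
      l (σ.charMap c.2 p) = Sum.inr ⟨c, p⟩ := by
  classical
  have step (n : ℕ) (a : σ.stage.obj n → X ⊕ Σ c : Σ d, σ.Cell d, 𝔻 c.1) :
      ∃ t : σ.stage.obj (n + 1) → X ⊕ Σ c : Σ d, σ.Cell d, 𝔻 c.1,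
        (∀ y, t (σ.stage.map (homOfLE n.le_succ) y) = a y) ∧
        ∀ d (s : (σ.stratum n).cells d) p, p ∉ Set.range (diskBoundaryInclusion d) →
          t ((σ.stratum n).char s p) = Sum.inr ⟨⟨d, n, s⟩, p⟩ := by
    obtain ⟨t, ht, ht'⟩ := (σ.stratum n).exists_fun a
      -- A boundary point inherits the location of its image under the attaching map; an interior
      -- point is its own location.
      (fun d s p => if h : p ∈ Set.range (diskBoundaryInclusion d)
        then a ((σ.stratum n).attach s h.choose) else Sum.inr ⟨⟨d, n, s⟩, p⟩) (fun d s b => by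
        have h : diskBoundaryInclusion d b ∈ Set.range (diskBoundaryInclusion d) := ⟨b, rfl⟩
        rw [dif_pos h, diskBoundaryInclusion_injective d h.choose_spec])
    exact ⟨t, ht, fun d s p hp => by rw [ht', dif_neg hp]⟩
  choose next hnext hnext' using step
  let a : ∀ n, σ.stage.obj n → X ⊕ Σ c : Σ d, σ.Cell d, 𝔻 c.1 :=
    fun n => Nat.rec (fun x => Sum.inl (σ.base.inv x)) next n
  obtain ⟨l, hl⟩ := σ.exists_bodyDesc (fun n => toIndiscrete (a n)) (fun n => by
    ext x
    exact hnext n (a n) x)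
  have hl' (n : ℕ) (x : σ.stage.obj n) : l (σ.toBody n x) = a n x :=
    ConcreteCategory.congr_hom (hl n) x
  refine ⟨l, fun x => ?_, fun ⟨d, n, s⟩ p hp => ?_⟩
  · have h₁ : f x = σ.toBody 0 (σ.base.hom x) :=
      (ConcreteCategory.congr_hom σ.base_toBody x).symm
    have h₂ : σ.base.inv (σ.base.hom x) = x := ConcreteCategory.congr_hom σ.base.hom_inv_id x
    rw [h₁, hl']
    exact congrArg Sum.inl h₂
  · exact (hl' (n + 1) _).trans (hnext' n (a n) d s p hp)

/-- A relative cell complex as a cell system. -/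
noncomputable def toSystem : CellSystem f :=
  have hl := σ.exists_locate.choose_spec
  have cases (y : Y) : (∃ x, f x = y) ∨ ∃ (c : Σ d, σ.Cell d) (p : 𝔻 c.1),
      p ∉ Set.range (diskBoundaryInclusion c.1) ∧ σ.charMap c.2 p = y := by
    obtain ⟨n, x, rfl⟩ := σ.exists_toBody y
    rcases σ.stage_cases x with h | ⟨d, m, -, s, h⟩
    · exact Or.inl h
    · exact Or.inr ⟨⟨d, m, s⟩, h⟩
  { cells := σ.Cell
    char := σ.charMap
    locate := σ.exists_locate.choose
    base_of_locate := fun {z x} h => by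
      rcases cases z with ⟨x', rfl⟩ | ⟨c, p, hp, rfl⟩
      · rw [Sum.inl.inj ((hl.1 x').symm.trans h)]
      · exact absurd ((hl.2 c p hp).symm.trans h) Sum.inr_ne_inl
    char_of_locate := fun {z c p} h => by
      rcases cases z with ⟨x, rfl⟩ | ⟨c', p', hp, rfl⟩
      · exact absurd ((hl.1 x).symm.trans h) Sum.inl_ne_inr
      · cases (hl.2 c' p' hp).symm.trans h
        rfl
    locate_base := hl.1
    locate_char := hl.2
    lower := InvImage (· < ·) fun c => c.2.1
    wf := InvImage.wf _ wellFounded_lt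
    lower_of_boundary := fun {c c' b p} h => by
      obtain ⟨d, n, s⟩ := c
      have h' := (congrArg σ.exists_locate.choose (σ.boundary_charMap_apply s b)).symm.trans h
      rcases σ.stage_cases ((σ.stratum n).attach s b) with ⟨x, hx⟩ | ⟨d', m, hm, s', p', hp', e⟩
      · rw [← hx] at h'
        exact absurd ((hl.1 x).symm.trans h') Sum.inl_ne_inr
      · rw [← e] at h'
        cases (hl.2 ⟨d', m, s'⟩ p' hp').symm.trans h'
        exact hm
    isClosed_of := fun A hf hc => σ.isClosed_of hf fun d s => hc ⟨d, s⟩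
    isClosed_boundary := fun A ⟨d, n, s⟩ hf hc => by
      change IsClosed ((diskBoundaryInclusion d ≫ σ.charMap ⟨n, s⟩) ⁻¹' A)
      rw [σ.boundary_charMap s]
      exact (σ.isClosed_toBody_preimage hf n fun m hm d s => hc ⟨d, m, s⟩ hm).preimage
        ((σ.stratum n).attach s).hom.continuous }

end CellStr

/-! ### Composites of relative cell complexes -/

namespace CellSystem

variable {X Y Z : TopCat.{u}} {f : X ⟶ Y} {g : Y ⟶ Z} (S : CellSystem f) (T : CellSystem g)

/-- The characteristic maps of a composite. -/
noncomputable def compChar {d : ℕ} : S.cells d ⊕ T.cells d → (𝔻 d ⟶ Z)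
  | .inl c => S.char c ≫ g
  | .inr c => T.char c

/-- The cells of a composite come from one of the two factors. -/
def splitIdx : (Σ d, S.cells d ⊕ T.cells d) → S.Idx ⊕ T.Idx
  | ⟨d, .inl c⟩ => .inl ⟨d, c⟩
  | ⟨d, .inr c⟩ => .inr ⟨d, c⟩

/-- The points of `Y`, in terms of the cells of a composite. -/
def locateLeft : (X ⊕ Σ c : S.Idx, 𝔻 c.1) → X ⊕ Σ c : Σ d, S.cells d ⊕ T.cells d, 𝔻 c.1
  | .inl x => .inl x
  | .inr ⟨c, p⟩ => .inr ⟨⟨c.1, .inl c.2⟩, p⟩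

/-- The points of `Z`, in terms of the cells of a composite. -/
def locateRight :
    (Y ⊕ Σ c : T.Idx, 𝔻 c.1) → X ⊕ Σ c : Σ d, S.cells d ⊕ T.cells d, 𝔻 c.1
  | .inl y => locateLeft S T (S.locate y)
  | .inr ⟨c, p⟩ => .inr ⟨⟨c.1, .inr c.2⟩, p⟩

lemma locateRight_base (y : Y) :
    locateRight S T (T.locate (g y)) = locateLeft S T (S.locate y) := by
  rw [T.locate_base]
  rfl

/-- The composite of two cell systems. -/
noncomputable def comp : CellSystem (f ≫ g) where
  cells d := S.cells d ⊕ T.cells d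
  char := compChar S T
  locate z := locateRight S T (T.locate z)
  base_of_locate {z x} h := by
    rcases e : T.locate z with y | ⟨c, p⟩
    · rw [e] at h
      change locateLeft S T (S.locate y) = _ at h
      rcases e' : S.locate y with x' | ⟨c, p⟩
      · rw [e'] at h
        cases h
        exact (congrArg g (S.base_of_locate e')).trans (T.base_of_locate e)
      · rw [e'] at h
        cases h
    · rw [e] at h
      cases h
  char_of_locate {z c p} h := by
    rcases e : T.locate z with y | ⟨c, p⟩
    · rw [e] at h
      change locateLeft S T (S.locate y) = _ at h
      rcases e' : S.locate y with x' | ⟨c, p⟩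
      · rw [e'] at h
        cases h
      · rw [e'] at h
        cases h
        exact (congrArg g (S.char_of_locate e')).trans (T.base_of_locate e)
    · rw [e] at h
      cases h
      exact T.char_of_locate e
  locate_base x := (locateRight_base S T (f x)).trans (by rw [S.locate_base]; rfl)
  locate_char := by
    rintro ⟨d, c | c⟩ p hp
    · refine (locateRight_base S T (S.char c p)).trans ?_
      rw [S.locate_char ⟨d, c⟩ p hp]
      rfl
    · change locateRight S T (T.locate (T.char c p)) = _
      rw [T.locate_char ⟨d, c⟩ p hp]
      rfl
  -- All cells of `S` precede all cells of `T`. Infinitely many cells may lie below one cell, which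
  -- is why a well-founded order replaces an index in `ℕ`.
  lower := InvImage (Sum.Lex S.lower T.lower) (splitIdx S T)
  wf := InvImage.wf _ (Sum.lex_wf S.wf T.wf)
  lower_of_boundary := by
    rintro ⟨d, c | c⟩ c' b p h
    · replace h := (locateRight_base S T (S.char c (diskBoundaryInclusion d b))).symm.trans h
      rcases e : S.locate (S.char c (diskBoundaryInclusion d b)) with x | ⟨c'', p'⟩
      · rw [e] at h
        cases h
      · rw [e] at h
        cases h
        exact Sum.Lex.inl (S.lower_of_boundary (c := ⟨d, c⟩) e)
    · change locateRight S T (T.locate (T.char c (diskBoundaryInclusion d b))) = _ at h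
      rcases e : T.locate (T.char c (diskBoundaryInclusion d b)) with y | ⟨c'', p'⟩
      · rw [e] at h
        change locateLeft S T (S.locate y) = _ at h
        rcases e' : S.locate y with x | ⟨c'', p'⟩
        · rw [e'] at h
          cases h
        · rw [e'] at h
          cases h
          exact Sum.Lex.sep _ _
      · rw [e] at h
        cases h
        exact Sum.Lex.inr (T.lower_of_boundary (c := ⟨d, c⟩) e)
  isClosed_of A hf hc :=
    T.isClosed_of A (S.isClosed_of (g ⁻¹' A) hf fun c => hc ⟨c.1, .inl c.2⟩)
      fun c => hc ⟨c.1, .inr c.2⟩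
  isClosed_boundary := by
    rintro A ⟨d, c | c⟩ hf hc
    · exact S.isClosed_boundary (g ⁻¹' A) ⟨d, c⟩ hf fun c' hc' =>
        hc ⟨c'.1, .inl c'.2⟩ (Sum.Lex.inl hc')
    · exact T.isClosed_boundary A ⟨d, c⟩
        (S.isClosed_of (g ⁻¹' A) hf fun c' => hc ⟨c'.1, .inl c'.2⟩ (Sum.Lex.sep _ _))
        fun c' hc' => hc ⟨c'.1, .inr c'.2⟩ (Sum.Lex.inr hc')

end CellSystem

theorem CellStr.exists_isComposite {X Y Z : TopCat.{u}} {f : X ⟶ Y} {g : Y ⟶ Z}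
    (σ : CellStr f) (τ : CellStr g) : ∃ ρ : CellStr (f ≫ g), σ.IsComposite τ ρ :=
  ⟨(σ.toSystem.comp τ.toSystem).toCellStr, (σ.toSystem.comp τ.toSystem).cellEquiv,
    fun _ _ => rfl, fun _ _ => rfl⟩

theorem proposition4p13 :
    (∀ {X Y Z : TopCat.{u}} {f : X ⟶ Y} {g : Y ⟶ Z} (σ : CellStr f) (τ : CellStr g),
      ∃ ρ : CellStr (f ≫ g), σ.IsComposite τ ρ) ∧
    ∀ (W : AWFS TopCat.{u}) (F : Discrete ℕ ⥤ W.LMap), F ⋙ W.forget = genCells →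
      ∃! F' : CellCx.{u} ⥤ W.LMap,
        F' ⋙ W.forget = CellCx.U ∧ F = CellCx.unit ⋙ F' ∧ CellCx.PreservesComposition F' :=
  ⟨fun σ τ => σ.exists_isComposite τ, CellCx.existsUnique_functor⟩
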